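/- **Operators and action convergence.** A (third-order) multi-$P$-operator is a bounded bilinear operator $A: L^\infty(\Omega)\times L^\infty(\Omega)\to L^1(\Omega)$ over a probability space $\Omega$. For $k\ge 1$ its $k$-profile $\mathcal S_k(A)$ is the set of the joint laws on $\mathbb R^{3k}$ of $(f_1,g_1,A[f_1,g_1],\dots,f_k,g_k,A[f_k,g_k])$, where $f_i,g_i\in L^\infty(\Omega)$ take values in $[-1,1]$ almost everywhere. Let $d_H$ be the Hausdorff distance of sets of probability measures on $\mathbb R^{3k}$ with respect to the Lévy–Prokhorov metric, and $d_M(A,B)=\sum_{k\ge1}2^{-k}d_H(\mathcal S_k(A),\mathcal S_k(B))$. A sequence $(A_n)$ action-converges to $A$ if it is Cauchy for $d_M$ and $d_H(\mathcal S_k(A_n),\mathcal S_k(A))\to0$ for every $k\ge 1$; limits $A,B$ are regarded as different if $d_M(A,B)>0$. **2-actions.** Let $H$ be a hypergraph on $[n]$ and let $T_{i,j,k}=\frac1n$ if $\{i,j,k\}$ is an edge of $H$ and $T_{i,j,k}=0$ otherwise (the normalized adjacency tensor). Its 2-action is the multi-$P$-operator on $[n]\times[n]$, with the $\sigma$-algebra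 of the sets invariant under $(i,k)\mapsto(k,i)$ and the uniform probability measure, given by $$T_2[f,g]_{i,k}=\tfrac12\Big(\sum_{j=1}^nT_{j,i,k}f_{j,i}g_{j,k}+\sum_{j=1}^nT_{j,k,i}f_{j,k}g_{j,i}\Big).$$ **Random hypergraphs.** $G(n,\frac18,3)$ is the 3-uniform hypergraph on $[n]$ in which every 3-subset is an edge independently with probability $\frac18$. $T(n,\frac12)$ is the 3-uniform hypergraph of the triangles of the Erdős–Rényi graph $G(n,\frac12)$. $TH(n)$ is the 3-uniform hypergraph of the vertex sets of the oriented 3-cycles of the random tournament on $[n]$ in which each pair of vertices is directed independently in either direction with probability $\frac12$. **Lemma.** For every $n\ge1$ let random hypergraphs distributed as $G(n,\frac18,3)$, $T(n,\frac12)$ and $TH(n)$ be given on one common probability space (with an arbitrary joint distribution), and let $(A_n)_2$, $(B_n)_2$, $(C_n)_2$ be the 2-actions of their normalized adjacency tensors. Then, almost surely: 1. every subsequence of each of the three sequences $((A_n)_2)_n$, $((B_n)_2)_n$, $((C_n)_2)_n$ has a further subsequence that action-converges to some multi-$P$-operator; 2. the three sequences have pairwise different action convergence limits, also along subsequences: if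 $K$ and $L$ are action convergence limits of (sub)sequences of two different ones of the three sequences, then $d_M(K,L)>0$; 3. the law of $(\mathbb 1,\mathbb 1,(C_n)_2[\mathbb 1,\mathbb 1])$, where $\mathbb 1$ is the function constantly equal to $1$ on $[n]\times[n]$, converges weakly to $\delta_{(1,1,1/4)}$ as $n\to\infty$. -/

import Mathlib

open MeasureTheory ProbabilityTheory Filter Topology
open scoped ENNReal unitInterval

universe u v w

noncomputable section

namespace ActionConv

/-! ### Third-order multi-`P`-operators and action convergence -/

/-- A third-order multi-`P`-operator: a probability space together with a bounded bilinear operator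
`L^∞ × L^∞ → L^1` on it. -/
structure MultiPOp : Type (u + 1) where
  Ω : Type u
  [mΩ : MeasurableSpace Ω]
  μ : Measure Ω
  [prob : IsProbabilityMeasure μ]
  op : Lp ℝ ∞ μ →L[ℝ] Lp ℝ ∞ μ →L[ℝ] Lp ℝ 1 μ

attribute [instance] MultiPOp.mΩ MultiPOp.prob

namespace MultiPOp

/-- The random vector `(f_1, g_1, A[f_1,g_1], …, f_k, g_k, A[f_k,g_k])`; the coordinate of index
`(i, c)` belongs to the `i`-th block. -/
def vec (A : MultiPOp.{u}) {k : ℕ} (f g : Fin k → Lp ℝ ∞ A.μ) (x : A.Ω) :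
    EuclideanSpace ℝ (Fin k × Fin 3) :=
  WithLp.toLp 2 fun p => ![f p.1 x, g p.1 x, A.op (f p.1) (g p.1) x] p.2

theorem measurable_vec (A : MultiPOp.{u}) {k : ℕ} (f g : Fin k → Lp ℝ ∞ A.μ) :
    Measurable (A.vec f g) := by
  refine (WithLp.measurable_toLp 2 (Fin k × Fin 3 → ℝ)).comp (measurable_pi_lambda _ ?_)
  rintro ⟨i, c⟩
  fin_cases c
  · exact (Lp.stronglyMeasurable (f i)).measurable
  · exact (Lp.stronglyMeasurable (g i)).measurable
  · exact (Lp.stronglyMeasurable (A.op (f i) (g i))).measurable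

/-- The law of `(f_1, g_1, A[f_1,g_1], …, f_k, g_k, A[f_k,g_k])`. -/
def law (A : MultiPOp.{u}) {k : ℕ} (f g : Fin k → Lp ℝ ∞ A.μ) :
    ProbabilityMeasure (EuclideanSpace ℝ (Fin k × Fin 3)) :=
  ⟨A.μ.map (A.vec f g), Measure.isProbabilityMeasure_map (A.measurable_vec f g).aemeasurable⟩

/-- The functions in `L^∞` with values in `[-1,1]` almost everywhere. -/
def unitFun (A : MultiPOp.{u}) : Set (Lp ℝ ∞ A.μ) :=
  {f | ∀ᵐ x ∂A.μ, f x ∈ Set.Icc (-1 : ℝ) 1}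

/-- The `k`-profile of `A`, in the space of laws with the Lévy–Prokhorov metric. -/
def profile (A : MultiPOp.{u}) (k : ℕ) :
    Set (LevyProkhorov (ProbabilityMeasure (EuclideanSpace ℝ (Fin k × Fin 3)))) :=
  {ν | ∃ f g : Fin k → Lp ℝ ∞ A.μ, (∀ i, f i ∈ A.unitFun) ∧ (∀ i, g i ∈ A.unitFun) ∧
    ν = LevyProkhorov.ofMeasure (A.law f g)}

/-- The action convergence (pseudo-)metric `d_M(A,B) = ∑_{k ≥ 1} 2^{-k} d_H(S_k(A), S_k(B))`. -/
def dM (A : MultiPOp.{u}) (B : MultiPOp.{v}) : ℝ≥0∞ :=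
  ∑' k : ℕ, 2⁻¹ ^ (k + 1) * Metric.hausdorffEDist (A.profile (k + 1)) (B.profile (k + 1))

/-- The all-ones function. -/
def one (A : MultiPOp.{u}) : Lp ℝ ∞ A.μ := Lp.const ∞ A.μ (1 : ℝ)

/-- The law of `(1, 1, A[1,1])`. -/
def lawOne (A : MultiPOp.{u}) : ProbabilityMeasure (EuclideanSpace ℝ (Fin 1 × Fin 3)) :=
  A.law (fun _ => A.one) (fun _ => A.one)

end MultiPOp

/-- The point `(a, b, c)` of `ℝ³`, the space of the laws in 1-profiles. -/
def point (a b c : ℝ) : EuclideanSpace ℝ (Fin 1 × Fin 3) :=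
  WithLp.toLp 2 fun p => ![a, b, c] p.2

/-- Action convergence of a sequence to `L`: the sequence is Cauchy for `d_M` and, for every
`k ≥ 1`, its `k`-profiles converge to the `k`-profile of `L`. -/
def ActionConverges (A : ℕ → MultiPOp.{u}) (L : MultiPOp.{v}) : Prop :=
  (∀ ε > 0, ∃ N, ∀ m ≥ N, ∀ n ≥ N, MultiPOp.dM (A m) (A n) < ε) ∧
  ∀ k : ℕ, 1 ≤ k →
    Tendsto (fun n => Metric.hausdorffEDist ((A n).profile k) (L.profile k)) atTop (𝓝 0)

/-- `L` is the action convergence limit of a subsequence of `A` (possibly of `A` itself). -/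
def IsSubseqLimit (A : ℕ → MultiPOp.{u}) (L : MultiPOp.{v}) : Prop :=
  ∃ φ : ℕ → ℕ, StrictMono φ ∧ ActionConverges (fun n => A (φ n)) L

/-- Every subsequence of `A` has a further subsequence with an action convergence limit. -/
def HasSubseqLimits (A : ℕ → MultiPOp.{0}) : Prop :=
  ∀ φ : ℕ → ℕ, StrictMono φ → ∃ L : MultiPOp.{0}, IsSubseqLimit (fun n => A (φ n)) L

/-- The limits of `A` and of `B`, also along subsequences, are different, that is, at positive
distance `d_M`. -/
def HaveDifferentLimits (A B : ℕ → MultiPOp.{0}) : Prop :=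
  ∀ (K : MultiPOp.{u}) (L : MultiPOp.{v}), IsSubseqLimit A K → IsSubseqLimit B L →
    0 < MultiPOp.dM K L

/-! ### The 2-action of a third-order tensor -/

section Tensor

variable (V : Type u)

/-- `V × V`, to be equipped with the symmetric σ-algebra. -/
def SymPair : Type u := V × V

variable {V} in
/-- The pair `(i,k)`. -/
def SymPair.mk (i k : V) : SymPair V := (i, k)

variable {V} in
/-- The first entry of a pair. -/
def SymPair.fst (x : SymPair V) : V := Prod.fst x

variable {V} in
/-- The second entry of a pair. -/
def SymPair.snd (x : SymPair V) : V := Prod.snd x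

/-- The symmetric σ-algebra: the sets invariant under `(i,k) ↦ (k,i)`. -/
instance : MeasurableSpace (SymPair V) where
  MeasurableSet' S := ∀ i k : V, SymPair.mk i k ∈ S ↔ SymPair.mk k i ∈ S
  measurableSet_empty := fun _ _ => Iff.rfl
  measurableSet_compl := fun _ h i k => not_congr (h i k)
  measurableSet_iUnion := fun s h i k => by
    have e : ∀ x : SymPair V, x ∈ ⋃ n, s n ↔ ∃ n, x ∈ s n := fun x => Set.mem_iUnion
    exact (e _).trans ((exists_congr fun n => h n i k).trans (e _).symm)

instance [Fintype V] : Fintype (SymPair V) := inferInstanceAs (Fintype (V × V))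

instance [Nonempty V] : Nonempty (SymPair V) := inferInstanceAs (Nonempty (V × V))

/-- The uniform probability measure on `V × V` with the symmetric σ-algebra. -/
def unif [Fintype V] : Measure (SymPair V) :=
  (Fintype.card (SymPair V) : ℝ≥0∞)⁻¹ • ∑ x : SymPair V, Measure.dirac x

variable {V}

theorem measurableSet_symPair {S : Set (SymPair V)} :
    MeasurableSet S ↔ ∀ i k : V, SymPair.mk i k ∈ S ↔ SymPair.mk k i ∈ S := Iff.rfl

theorem measurable_of_symm {h : SymPair V → ℝ} (hs : ∀ i k, h (.mk i k) = h (.mk k i)) :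
    Measurable h := by
  intro s _
  refine measurableSet_symPair.2 fun i k => ?_
  change h (.mk i k) ∈ s ↔ h (.mk k i) ∈ s
  rw [hs]

instance [Fintype V] [Nonempty V] : IsProbabilityMeasure (unif V) := by
  constructor
  have h : (Fintype.card (SymPair V) : ℝ≥0∞) ≠ 0 := by
    exact_mod_cast Fintype.card_ne_zero
  simp [unif, ENNReal.inv_mul_cancel h]

/-- A property true almost everywhere for the uniform measure is true everywhere. -/
theorem forall_of_ae [Fintype V] {p : SymPair V → Prop} (h : ∀ᵐ x ∂(unif V), p x) : ∀ x, p x := by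
  intro x
  by_contra hx
  obtain ⟨t, ht, hm, h0⟩ := exists_measurable_superset_of_null (ae_iff.1 h)
  have hxt : x ∈ t := ht hx
  have h1 : (Measure.dirac x : Measure (SymPair V)) t = 1 := by
    rw [Measure.dirac_apply' _ hm]; simp [hxt]
  have hc : (Fintype.card (SymPair V) : ℝ≥0∞)⁻¹ ≠ 0 := by simp
  rw [unif, Measure.smul_apply, smul_eq_mul, mul_eq_zero, Measure.finsetSum_apply,
    Finset.sum_eq_zero_iff] at h0
  rcases h0 with h0 | h0
  · exact hc h0
  · rw [h0 x (Finset.mem_univ x)] at h1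
    exact zero_ne_one h1

variable [Fintype V]

/-- The 2-action of a third-order tensor:
`T_2[f,g]_{i,k} = (∑_j T_{j,i,k} f_{j,i} g_{j,k} + ∑_j T_{j,k,i} f_{j,k} g_{j,i}) / 2`. -/
def twoAction (T : V → V → V → ℝ) (f g : SymPair V → ℝ) : SymPair V → ℝ := fun x =>
  (1 / 2 : ℝ) * (∑ j, T j x.fst x.snd * f (.mk j x.fst) * g (.mk j x.snd) +
    ∑ j, T j x.snd x.fst * f (.mk j x.snd) * g (.mk j x.fst))

theorem twoAction_symm (T : V → V → V → ℝ) (f g : SymPair V → ℝ) (i k : V) :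
    twoAction T f g (.mk i k) = twoAction T f g (.mk k i) := by
  simp only [twoAction]; rw [add_comm]; rfl

theorem abs_le_norm (f : Lp ℝ ∞ (unif V)) (x : SymPair V) : |f x| ≤ ‖f‖ := by
  have h : ∀ᵐ y ∂(unif V), |f y| ≤ ‖f‖ := by
    have := ae_le_eLpNormEssSup (f := (f : SymPair V → ℝ)) (μ := unif V)
    filter_upwards [this] with y hy
    rw [Lp.norm_def, eLpNorm_exponent_top, ← Real.norm_eq_abs, ← toReal_enorm]
    refine ENNReal.toReal_mono ?_ hy
    rw [← eLpNorm_exponent_top]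
    exact Lp.eLpNorm_ne_top f
  exact forall_of_ae h x

/-- A bound for the 2-action. -/
def tensorBound (T : V → V → V → ℝ) : ℝ := ∑ i, ∑ j, ∑ k, |T i j k|

theorem tensorBound_nonneg (T : V → V → V → ℝ) : 0 ≤ tensorBound T :=
  Finset.sum_nonneg fun _ _ => Finset.sum_nonneg fun _ _ => Finset.sum_nonneg fun _ _ =>
    abs_nonneg _

theorem sum_le_tensorBound (T : V → V → V → ℝ) (a b : V) : ∑ j, |T j a b| ≤ tensorBound T := by
  refine Finset.sum_le_sum fun j _ => ?_
  calc |T j a b| ≤ ∑ k, |T j a k| :=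
        Finset.single_le_sum (f := fun k => |T j a k|) (fun _ _ => abs_nonneg _)
          (Finset.mem_univ b)
    _ ≤ ∑ i, ∑ k, |T j i k| :=
        Finset.single_le_sum (f := fun i => ∑ k, |T j i k|)
          (fun _ _ => Finset.sum_nonneg fun _ _ => abs_nonneg _) (Finset.mem_univ a)

theorem twoAction_bound (T : V → V → V → ℝ) (f g : Lp ℝ ∞ (unif V)) (x : SymPair V) :
    |twoAction T f g x| ≤ tensorBound T * ‖f‖ * ‖g‖ := by
  have key : ∀ a b : V, |∑ j, T j a b * f (.mk j a) * g (.mk j b)| ≤ tensorBound T * ‖f‖ * ‖g‖ := by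
    intro a b
    calc |∑ j, T j a b * f (.mk j a) * g (.mk j b)|
        ≤ ∑ j, |T j a b * f (.mk j a) * g (.mk j b)| := Finset.abs_sum_le_sum_abs _ _
      _ ≤ ∑ j, |T j a b| * ‖f‖ * ‖g‖ := by
          refine Finset.sum_le_sum fun j _ => ?_
          rw [abs_mul, abs_mul]
          exact mul_le_mul (mul_le_mul_of_nonneg_left (abs_le_norm f _) (abs_nonneg _))
            (abs_le_norm g _) (abs_nonneg _) (by positivity)
      _ = (∑ j, |T j a b|) * ‖f‖ * ‖g‖ := by rw [Finset.sum_mul, Finset.sum_mul]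
      _ ≤ tensorBound T * ‖f‖ * ‖g‖ := by
          gcongr
          exact sum_le_tensorBound T a b
  have h1 := key x.fst x.snd
  have h2 := key x.snd x.fst
  rw [abs_le] at h1 h2 ⊢
  simp only [twoAction]
  constructor <;> linarith [h1.1, h1.2, h2.1, h2.2]

theorem coe_add_apply (f g : Lp ℝ ∞ (unif V)) (x : SymPair V) : (f + g) x = f x + g x :=
  forall_of_ae (Lp.coeFn_add f g) x

theorem coe_smul_apply (c : ℝ) (f : Lp ℝ ∞ (unif V)) (x : SymPair V) : (c • f) x = c * f x :=
  forall_of_ae (Lp.coeFn_smul c f) x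

variable [Nonempty V]

theorem memLp_twoAction (T : V → V → V → ℝ) (f g : Lp ℝ ∞ (unif V)) :
    MemLp (twoAction T f g) 1 (unif V) :=
  MemLp.of_bound (measurable_of_symm (twoAction_symm T f g)).aestronglyMeasurable
    (tensorBound T * ‖f‖ * ‖g‖) (Eventually.of_forall fun x => twoAction_bound T f g x)

/-- The 2-action as a bilinear operator `L^∞ × L^∞ → L^1`. -/
def twoActionLin (T : V → V → V → ℝ) :
    Lp ℝ ∞ (unif V) →ₗ[ℝ] Lp ℝ ∞ (unif V) →ₗ[ℝ] Lp ℝ 1 (unif V) :=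
  LinearMap.mk₂ ℝ (fun f g => (memLp_twoAction T f g).toLp)
    (fun f f' g => by
      rw [← MemLp.toLp_add]
      congr 1
      funext x
      simp only [twoAction, coe_add_apply, Pi.add_apply, mul_add, add_mul, Finset.sum_add_distrib]
      ring)
    (fun c f g => by
      rw [← MemLp.toLp_const_smul]
      congr 1
      funext x
      simp only [twoAction, coe_smul_apply, Pi.smul_apply, smul_eq_mul, mul_add, Finset.mul_sum]
      congr 1 <;> exact Finset.sum_congr rfl fun _ _ => by ring)
    (fun f g g' => by
      rw [← MemLp.toLp_add]
      congr 1
      funext x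
      simp only [twoAction, coe_add_apply, Pi.add_apply, mul_add, Finset.sum_add_distrib]
      ring)
    (fun c f g => by
      rw [← MemLp.toLp_const_smul]
      congr 1
      funext x
      simp only [twoAction, coe_smul_apply, Pi.smul_apply, smul_eq_mul, mul_add, Finset.mul_sum]
      congr 1 <;> exact Finset.sum_congr rfl fun _ _ => by ring)

theorem norm_twoActionLin (T : V → V → V → ℝ) (f g : Lp ℝ ∞ (unif V)) :
    ‖twoActionLin T f g‖ ≤ tensorBound T * ‖f‖ * ‖g‖ := by
  have hC : 0 ≤ tensorBound T * ‖f‖ * ‖g‖ :=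
    mul_nonneg (mul_nonneg (tensorBound_nonneg T) (norm_nonneg _)) (norm_nonneg _)
  have h : ∀ᵐ x ∂(unif V), ‖(twoActionLin T f g) x‖ ≤ tensorBound T * ‖f‖ * ‖g‖ := by
    filter_upwards [(memLp_twoAction T f g).coeFn_toLp] with x hx
    have : (twoActionLin T f g) x = twoAction T f g x := hx
    rw [this]
    exact twoAction_bound T f g x
  have h1 : measureUnivNNReal (unif V) = 1 := by
    simp [measureUnivNNReal]
  simpa [h1] using Lp.norm_le_of_ae_bound hC h

/-- The 2-action of a third-order tensor as a third-order multi-`P`-operator on `V × V` with the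
symmetric σ-algebra and the uniform probability measure. -/
def twoActionOp (T : V → V → V → ℝ) : MultiPOp.{u} where
  Ω := SymPair V
  μ := unif V
  op := (twoActionLin T).mkContinuous₂ (tensorBound T) (norm_twoActionLin T)

theorem twoActionOp_apply (T : V → V → V → ℝ) (f g : Lp ℝ ∞ (unif V)) (x : SymPair V) :
    ((twoActionOp T).op f g : Lp ℝ 1 (unif V)) x = twoAction T f g x :=
  forall_of_ae (memLp_twoAction T f g).coeFn_toLp x

end Tensor

/-! ### Hypergraphs and random hypergraphs -/

section Hypergraphs

variable {V : Type u}

open Classical in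
/-- The third-order adjacency tensor of a hypergraph. -/
def adjTensor (H : Hypergraph V) (i j k : V) : ℝ := if ({i, j, k} : Set V) ∈ H.edgeSet then 1 else 0

/-- The 2-action of the adjacency tensor of a hypergraph, divided by the number of vertices. -/
def hypergraphOp [Fintype V] [Nonempty V] (H : Hypergraph V) : MultiPOp.{u} :=
  twoActionOp fun i j k => adjTensor H i j k / (Fintype.card V : ℝ)

/-- The 3-uniform hypergraph of the triangles of a graph. -/
def triangleHypergraph (G : SimpleGraph V) : Hypergraph V where
  vertexSet := Set.univ
  edgeSet := {e | ∃ i j k, e = {i, j, k} ∧ G.Adj i j ∧ G.Adj j k ∧ G.Adj i k}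
  subset_vertexSet_of_mem_edgeSet' := fun _ _ => Set.subset_univ _

/-- The hypergraph of the oriented 3-cycles of a directed graph. -/
def cycleHypergraph (D : Digraph V) : Hypergraph V where
  vertexSet := Set.univ
  edgeSet := {e | ∃ i j k, e = {i, j, k} ∧ D.Adj i j ∧ D.Adj j k ∧ D.Adj k i}
  subset_vertexSet_of_mem_edgeSet' := fun _ _ => Set.subset_univ _

/-- A tournament: no loops, and exactly one direction for every pair of distinct vertices. -/
def IsTournament (D : Digraph V) : Prop :=
  (∀ i, ¬ D.Adj i i) ∧ ∀ i j, i ≠ j → Xor (D.Adj i j) (D.Adj j i)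

variable {Ω : Type v} [MeasurableSpace Ω]

/-- `H` is the random hypergraph `G(n,p,r)` on the vertex set `V`: every set of `r` vertices is an
edge with probability `p`, independently, and there are no other edges. -/
structure IsErdosRenyiHypergraph (P : Measure Ω) (p : I) (r : ℕ) (H : Ω → Hypergraph V) :
    Prop where
  vertexSet_eq : ∀ ω, (H ω).vertexSet = Set.univ
  hasLaw : HasLaw (fun ω => (H ω).edgeSet) (setBernoulli {e : Set V | e.ncard = r} p) P

/-- `D` is the random tournament `Tor(n)` on the ordered vertex set `V`: the direction of every pair
is chosen with equal probabilities, independently. -/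
structure IsRandomTournament [LinearOrder V] (P : Measure Ω) (D : Ω → Digraph V) : Prop where
  tournament : ∀ ω, IsTournament (D ω)
  hasLaw : HasLaw (fun ω => {e : V × V | e.1 < e.2 ∧ (D ω).Adj e.1 e.2})
    (setBernoulli {e : V × V | e.1 < e.2} ⟨1 / 2, by norm_num, by norm_num⟩) P

end Hypergraphs

end ActionConv

end

open ActionConv

/-! The value of `T₂[1,1]` at a pair is its codegree divided by the number of vertices, and this
function separates the three models. In `G(n,1/8,3)` the codegree of two distinct vertices is
binomial and close to `n/8`. In the tournament, if `i → k`, then `j` closes an oriented 3-cycle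
exactly when `k → j` and `j → i`; these are two independent fair arcs, so the codegree is close to
`n/4`. Hoeffding's inequality and Borel–Cantelli make both statements almost sure and uniform over
the quadratically many pairs (`ae_eventually_pattern_count`). In the triangle hypergraph the
codegree vanishes at every non-edge of the graph, hence at about half of all pairs, so `T₂[1,1]`
stays away in mean from every positive constant. Each estimate concerns one model only, so the joint
distribution plays no role.

Profiles remember this information. Since the tensor entries are at most `1/n`, Cauchy–Schwarz gives
`‖T₂[f,g]‖₁ ≤ ‖f‖₂ ‖g‖₂` (`integral_abs_twoAction_le`). If a 1-profile contains a law near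
`δ_(1,1,c)`, the functions `f, g` realizing it are close to `1` in `L²`, so `T₂[1,1]` is itself
close to `c` in `L¹` (`meanDev_le_of_edist_lt`). Thus one 1-profile approaches `δ_(1,1,c)` while the
other stays away from it, and the limits differ (`haveDifferentLimits_of_meanDev`).

Existence of limits is deterministic and needs only the bound `1/n` on the entries
(`exists_isSubseqLimit`). A uniformly bounded sequence of symmetric functions, one for each `n`, is
a single continuous function on the Stone–Čech compactification of the disjoint union of the sets of
unordered pairs. The uniform measures have a limit there along a nonprincipal ultrafilter. The
2-actions, applied level by level, form a bilinear map on continuous functions; the `L²` estimate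
survives in the limit and extends this map to `L²`. Every law of continuous functions is the limit
of the laws of their restrictions to the levels. For one half of the Hausdorff distance, badly
approximable functions chosen level by level glue to continuous functions, whose law contradicts the
choice. For the other half, the laws of continuous functions approximate the whole profile of the
limit and are totally bounded by Prokhorov's theorem, so a finite net suffices. A diagonal argument
turns the ultrafilter into a subsequence. -/

namespace ActionConv

/-! ### Concentration for Bernoulli random sets -/

section Concentration

open unitInterval in
/-- The restriction of a Bernoulli random set to a family of disjoint blocks of coordinates. -/
theorem setBernoulli_map_blocks {ι J κ : Type*} [Countable ι] {s : Set ι} (p : I)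
    {a : J × κ → ι} (ha : Function.Injective a) (hs : ∀ x, a x ∈ s) :
    (setBernoulli s p).map (fun S (j : J) (k : κ) => a (j, k) ∈ S) =
      Measure.infinitePi fun _ : J => Measure.infinitePi fun _ : κ =>
        (toNNReal p • Measure.dirac True + toNNReal (σ p) • Measure.dirac False) := by
  have hset : Measurable (fun q : ι → Prop => {i | q i}) :=
    MeasurableEquiv.setOfPred.measurable
  have hmem : Measurable (fun (S : Set ι) (j : J) (k : κ) => a (j, k) ∈ S) :=
    measurable_pi_lambda _ fun j => measurable_pi_lambda _ fun k => measurable_set_mem _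
  rw [setBernoulli_eq_map, Measure.map_map hmem hset,
    ← Measure.infinitePi_map_curry (fun (_ : J) (_ : κ) =>
      (toNNReal p • Measure.dirac True + toNNReal (σ p) • Measure.dirac False : Measure Prop))]
  have h := Measure.map_infinitePi_infinitePi_of_inj
    (P := fun i : ι => (toNNReal p • Measure.dirac (i ∈ s) + toNNReal (σ p) • Measure.dirac False :
      Measure Prop)) ha
  -- All indices of the blocks lie in `s`, so none of these coordinates is forced to be `False`.
  have h' : ∀ x, (a x ∈ s) = True := fun x => eq_true (hs x)
  simp only [h'] at h
  rw [← h, Measure.map_map (by fun_prop) (by fun_prop)]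
  rfl

open unitInterval in
-- The joint law of the blocks is a product measure, and its factors are the marginals.
theorem setBernoulli_iIndepFun_blocks {ι J κ : Type*} [Countable ι] {s : Set ι} (p : I)
    {a : J × κ → ι} (ha : Function.Injective a) (hs : ∀ x, a x ∈ s) :
    iIndepFun (fun (j : J) (S : Set ι) (k : κ) => a (j, k) ∈ S) (setBernoulli s p) := by
  have hmem : ∀ j : J, Measurable (fun (S : Set ι) (k : κ) => a (j, k) ∈ S) :=
    fun j => measurable_pi_lambda _ fun k => measurable_set_mem _
  rw [iIndepFun_iff_map_fun_eq_infinitePi_map hmem, setBernoulli_map_blocks p ha hs]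
  congr 1
  funext j
  rw [← Measure.infinitePi_map_eval (fun _ : J => Measure.infinitePi fun _ : κ =>
        (toNNReal p • Measure.dirac True + toNNReal (σ p) • Measure.dirac False)) j,
    ← setBernoulli_map_blocks p ha hs, Measure.map_map (by fun_prop) (measurable_pi_lambda _ hmem)]
  rfl

open unitInterval in
open Classical in
theorem setBernoulli_real_pattern {ι J κ : Type*} [Countable ι] [Fintype κ] {s : Set ι} (p : I)
    {a : J × κ → ι} (ha : Function.Injective a) (hs : ∀ x, a x ∈ s) (j : J) (t : κ → Prop) :
    (setBernoulli s p).real {S | ∀ k, a (j, k) ∈ S ↔ t k} =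
      ∏ k, if t k then (p : ℝ) else 1 - p := by
  have hmem : ∀ j : J, Measurable (fun (S : Set ι) (k : κ) => a (j, k) ∈ S) :=
    fun j => measurable_pi_lambda _ fun k => measurable_set_mem _
  have hmap : (setBernoulli s p).map (fun S (k : κ) => a (j, k) ∈ S) =
      Measure.infinitePi fun _ : κ =>
        (toNNReal p • Measure.dirac True + toNNReal (σ p) • Measure.dirac False) := by
    rw [← Measure.infinitePi_map_eval (fun _ : J => Measure.infinitePi fun _ : κ =>
        (toNNReal p • Measure.dirac True + toNNReal (σ p) • Measure.dirac False)) j,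
      ← setBernoulli_map_blocks p ha hs,
      Measure.map_map (by fun_prop) (measurable_pi_lambda _ hmem)]
    rfl
  have hset : {S : Set ι | ∀ k, a (j, k) ∈ S ↔ t k} =
      (fun (S : Set ι) (k : κ) => a (j, k) ∈ S) ⁻¹' {t} := by
    ext S
    simp [funext_iff]
  rw [hset, measureReal_def, ← Measure.map_apply (hmem j) (measurableSet_singleton t), hmap,
    Measure.infinitePi_singleton_of_fintype, ENNReal.toReal_prod]
  refine Finset.prod_congr rfl fun k _ => ?_
  by_cases hk : t k <;> simp [hk]

open Classical in
/-- Hoeffding's inequality for the number of blocks of coordinates at which a Bernoulli random set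
shows a given pattern. -/
theorem setBernoulli_deviation {ι J κ : Type*} [Countable ι] [Fintype J] [Fintype κ] {s : Set ι}
    (p : I) {a : J × κ → ι} (ha : Function.Injective a) (hs : ∀ x, a x ∈ s) (t : J → κ → Prop)
    {m : ℝ} (hm : ∀ j, (∏ k, if t j k then (p : ℝ) else 1 - p) = m) {ε : ℝ} (hε : 0 ≤ ε) :
    (setBernoulli s p).real
      {S | ε ≤ |∑ j, ((if ∀ k, a (j, k) ∈ S ↔ t j k then (1 : ℝ) else 0) - m)|} ≤
      2 * Real.exp (-2 * ε ^ 2 / Fintype.card J) := by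
  set μ := setBernoulli s p
  let ψ : (j : J) → (κ → Prop) → ℝ := fun j q => (if q = t j then 1 else 0) - m
  let X : J → Set ι → ℝ := fun j S => (if ∀ k, a (j, k) ∈ S ↔ t j k then (1 : ℝ) else 0) - m
  have hψ : ∀ j, Measurable (ψ j) := fun j => .of_discrete
  have hX : X = fun j => ψ j ∘ fun (S : Set ι) (k : κ) => a (j, k) ∈ S := by
    funext j S
    simp [X, ψ, funext_iff]
  have hmemS : ∀ j, MeasurableSet {S : Set ι | ∀ k, a (j, k) ∈ S ↔ t j k} := by
    intro j
    have hset : {S : Set ι | ∀ k, a (j, k) ∈ S ↔ t j k} =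
        (fun (S : Set ι) (k : κ) => a (j, k) ∈ S) ⁻¹' {t j} := by
      ext S
      simp [funext_iff]
    rw [hset]
    exact (measurable_pi_lambda _ fun k => measurable_set_mem _) (measurableSet_singleton _)
  have hind : iIndepFun X μ := by
    rw [hX]
    exact (setBernoulli_iIndepFun_blocks p ha hs).comp ψ hψ
  -- Hoeffding's lemma: a centred variable with range of length 1 has sub-Gaussian parameter `1/4`.
  -- The sum then has parameter `|J|/4`, which gives the exponent `-2ε²/|J|`.
  have hsub : ∀ j ∈ Finset.univ, HasSubgaussianMGF (X j) ((‖(1 : ℝ) - 0‖₊ / 2) ^ 2) μ := by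
    intro j _
    have hmeas : Measurable fun S : Set ι => if ∀ k, a (j, k) ∈ S ↔ t j k then (1 : ℝ) else 0 :=
      Measurable.ite (hmemS j) measurable_const measurable_const
    have hint : μ[fun S : Set ι => if ∀ k, a (j, k) ∈ S ↔ t j k then (1 : ℝ) else 0] = m := by
      rw [← hm j, ← setBernoulli_real_pattern p ha hs j (t j), ← integral_indicator_one (hmemS j)]
      refine integral_congr_ae (Eventually.of_forall fun S => ?_)
      simp [Set.indicator_apply]
    have := hasSubgaussianMGF_of_mem_Icc (μ := μ) (a := 0) (b := 1) hmeas.aemeasurable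
      (Eventually.of_forall fun S => by
        by_cases h : ∀ k, a (j, k) ∈ S ↔ t j k <;> simp [h])
    rwa [hint] at this
  have key : ∀ Y : J → Set ι → ℝ, iIndepFun Y μ →
      (∀ j ∈ Finset.univ, HasSubgaussianMGF (Y j) ((‖(1 : ℝ) - 0‖₊ / 2) ^ 2) μ) →
      μ.real {S | ε ≤ ∑ j, Y j S} ≤ Real.exp (-2 * ε ^ 2 / Fintype.card J) := by
    intro Y hY hYs
    refine (HasSubgaussianMGF.measure_sum_ge_le_of_iIndepFun hY hYs hε).trans (le_of_eq ?_)
    congr 1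
    simp only [Finset.sum_const, Finset.card_univ, nsmul_eq_mul]
    push_cast
    norm_num
    rcases eq_or_ne (Fintype.card J : ℝ) 0 with h | h
    · simp [h]
    · field_simp
      ring
  have h1 := key X hind hsub
  -- The lower tail is the upper tail of the negated variables.
  have h2 := key (fun j => -X j) (hind.comp (fun _ x => -x) fun _ => measurable_neg)
    (fun j hj => (hsub j hj).neg)
  have hsubset : {S : Set ι | ε ≤ |∑ j, X j S|} ⊆
      {S | ε ≤ ∑ j, X j S} ∪ {S | ε ≤ ∑ j, (-X j) S} := by
    intro S hS
    rcases le_abs'.1 (show ε ≤ |∑ j, X j S| from hS) with h | h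
    · right
      simp only [Set.mem_ofPred_eq, Pi.neg_apply, Finset.sum_neg_distrib]
      linarith
    · exact Or.inl h
  calc μ.real {S : Set ι | ε ≤ |∑ j, X j S|}
      ≤ μ.real ({S | ε ≤ ∑ j, X j S} ∪ {S | ε ≤ ∑ j, (-X j) S}) := measureReal_mono hsubset
    _ ≤ _ := measureReal_union_le _ _
    _ ≤ _ := by linarith

/-- A Borel–Cantelli argument: quadratically many events of exponentially small probabilities. -/
theorem ae_eventually_forall_notMem {Ω : Type*} [MeasurableSpace Ω] (P : Measure Ω)
    [IsProbabilityMeasure P] {Q : ℕ → Type*} [∀ n, Fintype (Q n)]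
    (hQ : ∀ n, Fintype.card (Q n) ≤ (n + 1) ^ 2) (bad : ∀ n, Q n → Set Ω) {c : ℝ} (hc : 0 < c)
    (h : ∀ n q, P.real (bad n q) ≤ 2 * Real.exp (-c * (n + 1))) :
    ∀ᵐ ω ∂P, ∀ᶠ n in atTop, ∀ q, ω ∉ bad n q := by
  have hle : ∀ n, P (⋃ q, bad n q) ≤
      ENNReal.ofReal (((n + 1 : ℕ) : ℝ) ^ 2 * Real.exp (-c * (n + 1 : ℕ)) * 2) := by
    intro n
    have h1 : P.real (⋃ q, bad n q) ≤ ((n + 1 : ℕ) : ℝ) ^ 2 * Real.exp (-c * (n + 1 : ℕ)) * 2 := by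
      calc P.real (⋃ q, bad n q) ≤ ∑ q, P.real (bad n q) := measureReal_iUnion_fintype_le _
        _ ≤ ∑ _q : Q n, 2 * Real.exp (-c * (n + 1)) := Finset.sum_le_sum fun q _ => h n q
        _ = Fintype.card (Q n) * (2 * Real.exp (-c * (n + 1))) := by simp
        _ ≤ ((n + 1 : ℕ) : ℝ) ^ 2 * (2 * Real.exp (-c * (n + 1))) := by
            gcongr
            exact_mod_cast hQ n
        _ = _ := by push_cast; ring
    rw [← ENNReal.ofReal_toReal (measure_ne_top P _)]
    exact ENNReal.ofReal_le_ofReal h1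
  have hsum : Summable fun n : ℕ =>
      ((n + 1 : ℕ) : ℝ) ^ 2 * Real.exp (-c * (n + 1 : ℕ)) * 2 :=
    (((summable_nat_add_iff 1).2 (Real.summable_pow_mul_exp_neg_nat_mul 2 hc))).mul_right 2
  have hfin : ∑' n, P (⋃ q, bad n q) ≠ ∞ :=
    ne_top_of_le_ne_top hsum.tsum_ofReal_ne_top (ENNReal.tsum_le_tsum hle)
  filter_upwards [ae_eventually_notMem hfin] with ω hω
  filter_upwards [hω] with n hn q hq
  exact hn (Set.mem_iUnion.2 ⟨q, hq⟩)

open Classical in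
/-- Almost surely and uniformly over at most `(n+1)²` families of blocks, the number of blocks at
which the random sets show the given patterns is close to its expectation. -/
theorem ae_eventually_pattern_count {Ω : Type*} [MeasurableSpace Ω] (P : Measure Ω)
    [IsProbabilityMeasure P] {ι : ℕ → Type*} [∀ n, Countable (ι n)] {s : ∀ n, Set (ι n)} {p : I}
    {S : ∀ n, Ω → Set (ι n)} (hS : ∀ n, HasLaw (S n) (setBernoulli (s n) p) P)
    {Q : ℕ → Type*} [∀ n, Fintype (Q n)] (hQ : ∀ n, Fintype.card (Q n) ≤ (n + 1) ^ 2)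
    {J : ∀ n, Q n → Type*} [∀ n q, Fintype (J n q)]
    (hJ : ∀ n q, Fintype.card (J n q) ≤ n + 1) {κ : Type*} [Fintype κ]
    (a : ∀ n (q : Q n), J n q × κ → ι n) (ha : ∀ n q, Function.Injective (a n q))
    (hs : ∀ n q x, a n q x ∈ s n) (t : ∀ n q, J n q → κ → Prop) {m : ℝ}
    (hm : ∀ n q j, (∏ k, if t n q j k then (p : ℝ) else 1 - p) = m) :
    ∀ᵐ ω ∂P, ∀ ε > 0, ∀ᶠ n : ℕ in atTop, ∀ q : Q n,
      |∑ j, ((if ∀ k, a n q (j, k) ∈ S n ω ↔ t n q j k then (1 : ℝ) else 0) - m)| < ε * (n + 1) := by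
  have hε : ∀ ε : ℝ, 0 < ε → ∀ᵐ ω ∂P, ∀ᶠ n : ℕ in atTop, ∀ q : Q n,
      |∑ j, ((if ∀ k, a n q (j, k) ∈ S n ω ↔ t n q j k then (1 : ℝ) else 0) - m)|
        < ε * (n + 1) := by
    intro ε hε
    let bad : ∀ n, Q n → Set (Set (ι n)) := fun n q => {A | ε * (n + 1) ≤
      |∑ j, ((if ∀ k, a n q (j, k) ∈ A ↔ t n q j k then (1 : ℝ) else 0) - m)|}
    have := ae_eventually_forall_notMem P hQ (fun n q => S n ⁻¹' bad n q)
      (c := 2 * ε ^ 2) (by positivity) (fun n q => ?_)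
    · filter_upwards [this] with ω hω
      filter_upwards [hω] with n hn q
      exact not_le.1 (hn q)
    · have h1 : P.real (S n ⁻¹' bad n q) ≤ (setBernoulli (s n) p).real (bad n q) := by
        rw [← (hS n).map_eq]
        -- This inequality holds for arbitrary sets, so the bad set need not be shown measurable.
        have := (hS n).map_eq ▸ Measure.le_map_apply (hS n).aemeasurable (bad n q)
        rw [(hS n).map_eq]
        exact ENNReal.toReal_mono (measure_ne_top _ _) this
      refine h1.trans ?_
      -- Without blocks the Hoeffding bound degenerates to `2`, because division by zero gives `0`;
      -- but then the sum is empty and the bad event is void.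
      rcases (Fintype.card (J n q)).eq_zero_or_pos with h0 | h0
      · have hemp : IsEmpty (J n q) := Fintype.card_eq_zero_iff.1 h0
        have hb : bad n q = ∅ := by
          ext A
          simp only [bad, Finset.univ_eq_empty, Finset.sum_empty, abs_zero, Set.mem_ofPred_eq,
            Set.mem_empty_iff_false, iff_false, not_le]
          positivity
        rw [hb, measureReal_empty]
        positivity
      · refine (setBernoulli_deviation p (ha n q) (hs n q) (t n q) (hm n q)
          (by positivity)).trans ?_
        -- At deviation `ε(n+1)` the exponent is `-2ε²(n+1)²/|J|`, and `|J| ≤ n+1` makes it at most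
        -- `-2ε²(n+1)`.
        gcongr 2 * Real.exp ?_
        have hJ' : (Fintype.card (J n q) : ℝ) ≤ n + 1 := by exact_mod_cast hJ n q
        have h0' : (0 : ℝ) < Fintype.card (J n q) := by exact_mod_cast h0
        rw [div_le_iff₀ h0']
        have : (0 : ℝ) ≤ ε ^ 2 * (n + 1) := by positivity
        nlinarith
  -- Countably many tolerances suffice, so a single null set serves all `ε`.
  filter_upwards [ae_all_iff.2 fun k : ℕ => hε (1 / ((k : ℝ) + 1)) (by positivity)] with ω hω ε h
  obtain ⟨k, hk⟩ := exists_nat_one_div_lt h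
  filter_upwards [hω k] with n hn q
  refine (hn q).trans_le ?_
  gcongr

end Concentration

/-! ### Codegrees -/

section Codegree

variable {V : Type*}

theorem adjTensor_nonneg (H : Hypergraph V) (i j k : V) : 0 ≤ adjTensor H i j k := by
  unfold adjTensor; split_ifs <;> norm_num

theorem adjTensor_le_one (H : Hypergraph V) (i j k : V) : adjTensor H i j k ≤ 1 := by
  unfold adjTensor; split_ifs <;> norm_num

theorem adjTensor_swap (H : Hypergraph V) (i j k : V) : adjTensor H i j k = adjTensor H i k j := by
  unfold adjTensor
  rw [Set.pair_comm j k]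

theorem adjTensor_triangleHypergraph_eq_zero {G : SimpleGraph V} {i k : V} (hik : i ≠ k)
    (h : ¬ G.Adj i k) (j : V) : adjTensor (triangleHypergraph G) j i k = 0 := by
  unfold adjTensor
  rw [if_neg]
  rintro ⟨a, b, c, he, hab, hbc, hac⟩
  have hi : i ∈ ({a, b, c} : Set V) := he ▸ by simp
  have hk : k ∈ ({a, b, c} : Set V) := he ▸ by simp
  have := hab.symm
  have := hbc.symm
  have := hac.symm
  simp only [Set.mem_insert_iff, Set.mem_singleton_iff] at hi hk
  rcases hi with rfl | rfl | rfl <;> rcases hk with rfl | rfl | rfl <;> first | exact hik rfl | exact h ‹_›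

/-- An oriented cycle on the three vertices must use the arc `i → k`, which determines its
orientation. What remains is a condition on two arcs at `j`; for different `j` these arcs are
different, which provides independence. -/
theorem cycleHypergraph_edge_iff {D : Digraph V} (hD : IsTournament D) {i j k : V} (hik : D.Adj i k)
    (hji : j ≠ i) (hjk : j ≠ k) :
    ({j, i, k} : Set V) ∈ (cycleHypergraph D).edgeSet ↔ D.Adj k j ∧ D.Adj j i := by
  have hasymm : ∀ x y, D.Adj x y → ¬ D.Adj y x := by
    intro x y h h'
    rcases eq_or_ne x y with rfl | hne
    · exact hD.1 _ h
    · rcases hD.2 x y hne with ⟨_, h2⟩ | ⟨_, h2⟩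
      exacts [h2 h', h2 h]
  constructor
  · rintro ⟨a, b, c, he, hab, hbc, hca⟩
    have hi : i ∈ ({a, b, c} : Set V) := he ▸ by simp
    have hk : k ∈ ({a, b, c} : Set V) := he ▸ by simp
    have hj : j ∈ ({a, b, c} : Set V) := he ▸ by simp
    simp only [Set.mem_insert_iff, Set.mem_singleton_iff] at hi hk hj
    have hik' : i ≠ k := fun h => hD.1 k (h ▸ hik)
    have h1 := hasymm _ _ hab
    have h2 := hasymm _ _ hbc
    have h3 := hasymm _ _ hca
    rcases hi with rfl | rfl | rfl <;> rcases hk with rfl | rfl | rfl <;>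
      rcases hj with rfl | rfl | rfl <;> first | exact absurd rfl ‹_› | tauto
  · rintro ⟨hkj, hji'⟩
    exact ⟨j, i, k, rfl, hji', hik, hkj⟩

variable [Fintype V]

theorem abs_sum_le_subtype_ne [DecidableEq V] {f : V → ℝ} (hf : ∀ j, |f j| ≤ 1) (i k : V) :
    |∑ j, f j| ≤ |∑ j : {j // j ≠ i ∧ j ≠ k}, f j| + 2 := by
  have h1 : ∑ j : {j // j ≠ i ∧ j ≠ k}, f j = ∑ j ∈ Finset.univ.filter (fun j => j ≠ i ∧ j ≠ k), f j :=
    (Finset.sum_subtype _ (by simp) f).symm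
  have h2 : ∑ j, f j = ∑ j ∈ Finset.univ.filter (fun j => j ≠ i ∧ j ≠ k), f j +
      ∑ j ∈ Finset.univ.filter (fun j => ¬ (j ≠ i ∧ j ≠ k)), f j :=
    (Finset.sum_filter_add_sum_filter_not _ _ _).symm
  have h3 : |∑ j ∈ Finset.univ.filter (fun j => ¬ (j ≠ i ∧ j ≠ k)), f j| ≤ 2 := by
    refine (Finset.abs_sum_le_sum_abs _ _).trans ((Finset.sum_le_card_nsmul _ _ 1
      fun j _ => hf j).trans ?_)
    have : Finset.univ.filter (fun j => ¬ (j ≠ i ∧ j ≠ k)) ⊆ {i, k} := by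
      intro j hj
      simp only [Finset.mem_filter, Finset.mem_univ, true_and] at hj
      simp only [Finset.mem_insert, Finset.mem_singleton]
      tauto
    have hcard := (Finset.card_le_card this).trans Finset.card_le_two
    simp only [nsmul_eq_mul, mul_one]
    exact_mod_cast hcard
  rw [h1, h2]
  exact (abs_add_le _ _).trans (by linarith)

/-- Symmetry of `h` is its measurability for the symmetric σ-algebra, which allows the integrals
against Dirac measures to be evaluated. -/
theorem integral_unif {h : SymPair V → ℝ} (hs : ∀ i k, h (.mk i k) = h (.mk k i)) :
    ∫ x, h x ∂(unif V) = ((Fintype.card V : ℝ) ^ 2)⁻¹ * ∑ i, ∑ k, h (.mk i k) := by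
  have hm : StronglyMeasurable h := (measurable_of_symm hs).stronglyMeasurable
  have hcard : (Fintype.card (SymPair V) : ℝ) = (Fintype.card V : ℝ) ^ 2 := by
    have : Fintype.card (SymPair V) = Fintype.card V * Fintype.card V :=
      Fintype.card_prod V V
    rw [this]
    push_cast
    ring
  have hint : ∀ x : SymPair V, ∫ y, h y ∂(Measure.dirac x) = h x := fun x =>
    integral_dirac' h x hm
  have hI : ∀ x ∈ (Finset.univ : Finset (SymPair V)), Integrable h (Measure.dirac x) := fun x _ =>
    integrable_dirac' hm enorm_lt_top
  rw [unif, integral_smul_measure, integral_finsetSum_measure hI]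
  simp only [hint, smul_eq_mul, ENNReal.toReal_inv, ENNReal.toReal_natCast, hcard]
  congr 1
  exact Fintype.sum_prod_type (f := h)

/-- The mean distance of `T₂[1,1]` from the constant `c`. -/
noncomputable def meanDev (T : V → V → V → ℝ) (c : ℝ) : ℝ :=
  ∫ x, |twoAction T (fun _ => 1) (fun _ => 1) x - c| ∂(unif V)

theorem meanDev_eq (T : V → V → V → ℝ) (c : ℝ) :
    meanDev T c = ((Fintype.card V : ℝ) ^ 2)⁻¹ *
      ∑ i, ∑ k, |twoAction T (fun _ => 1) (fun _ => 1) (.mk i k) - c| :=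
  integral_unif fun i k => by rw [twoAction_symm]

/-- The adjacency tensor divided by the number of vertices. -/
noncomputable def normTensor (H : Hypergraph V) (i j k : V) : ℝ := adjTensor H i j k / (Fintype.card V : ℝ)

theorem twoAction_normTensor_one (H : Hypergraph V) (i k : V) :
    twoAction (normTensor H) (fun _ => 1) (fun _ => 1) (.mk i k) =
      (∑ j, adjTensor H j i k) / Fintype.card V := by
  have h : ∀ x : V × V, twoAction (normTensor H) (fun _ => 1) (fun _ => 1) (.mk x.1 x.2) =
      (1 / 2 : ℝ) * (∑ j, normTensor H j x.1 x.2 * 1 * 1 + ∑ j, normTensor H j x.2 x.1 * 1 * 1) :=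
    fun _ => rfl
  have := h (i, k)
  simp only [mul_one] at this
  rw [this]
  simp only [normTensor, adjTensor_swap H _ k i, ← Finset.sum_div]
  ring

variable [Nonempty V]

theorem twoAction_normTensor_one_mem (H : Hypergraph V) (i k : V) :
    twoAction (normTensor H) (fun _ => 1) (fun _ => 1) (.mk i k) ∈ Set.Icc (0 : ℝ) 1 := by
  rw [twoAction_normTensor_one]
  have hc : (0 : ℝ) < Fintype.card V := by exact_mod_cast Fintype.card_pos
  refine ⟨div_nonneg (Finset.sum_nonneg fun _ _ => adjTensor_nonneg _ _ _ _) hc.le, ?_⟩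
  rw [div_le_one hc]
  calc ∑ j, adjTensor H j i k ≤ ∑ _j : V, (1 : ℝ) :=
        Finset.sum_le_sum fun _ _ => adjTensor_le_one _ _ _ _
    _ = Fintype.card V := by simp

/-- The diagonal carries a fraction `1/n` of the pairs, and there the deviation is at most `1`
because both quantities lie in `[0,1]`. -/
theorem meanDev_le {H : Hypergraph V} {c ε : ℝ} (hc : c ∈ Set.Icc (0 : ℝ) 1) (hε : 0 ≤ ε)
    (h : ∀ i k, i ≠ k → |(∑ j, adjTensor H j i k) / Fintype.card V - c| ≤ ε) :
    meanDev (normTensor H) c ≤ ε + 1 / Fintype.card V := by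
  classical
  have hN : (0 : ℝ) < Fintype.card V := by exact_mod_cast Fintype.card_pos
  rw [meanDev_eq]
  have hle : ∀ i k : V, |twoAction (normTensor H) (fun _ => 1) (fun _ => 1) (.mk i k) - c| ≤
      ε + if i = k then 1 else 0 := by
    intro i k
    by_cases hik : i = k
    · have h1 := twoAction_normTensor_one_mem H i k
      simp only [hik, if_true] at h1 ⊢
      rw [abs_le]
      constructor <;> linarith [h1.1, h1.2, hc.1, hc.2]
    · rw [twoAction_normTensor_one]
      simpa [hik] using h i k hik
  calc ((Fintype.card V : ℝ) ^ 2)⁻¹ *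
      ∑ i, ∑ k, |twoAction (normTensor H) (fun _ => 1) (fun _ => 1) (.mk i k) - c|
      ≤ ((Fintype.card V : ℝ) ^ 2)⁻¹ * ∑ i : V, ∑ k : V, (ε + if i = k then 1 else 0) := by
        gcongr
        exact hle _ _
    _ = ε + 1 / Fintype.card V := by
        simp only [Finset.sum_add_distrib, Finset.sum_ite_eq, Finset.mem_univ, if_true,
          Finset.sum_const, Finset.card_univ, nsmul_eq_mul]
        field_simp

end Codegree

/-! ### Codegrees of the three random hypergraphs -/

section RandomCodegree

theorem tendsto_meanDev {H : ∀ n : ℕ, Hypergraph (Fin (n + 1))} {c : ℝ} (hc : c ∈ Set.Icc (0 : ℝ) 1)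
    (h : ∀ ε > 0, ∀ᶠ n : ℕ in atTop, ∀ i k : Fin (n + 1), i ≠ k →
      |∑ j : {j // j ≠ i ∧ j ≠ k}, (adjTensor (H n) j i k - c)| < ε * (n + 1)) :
    Tendsto (fun n => meanDev (normTensor (H n)) c) atTop (𝓝 0) := by
  rw [Metric.tendsto_atTop']
  intro ε hε
  have h1 := h (ε / 4) (by positivity)
  have h2 : ∀ᶠ n : ℕ in atTop, 2 / ((n : ℝ) + 1) < ε / 4 := by
    have : Tendsto (fun n : ℕ => 2 * (1 / ((n : ℝ) + 1))) atTop (𝓝 (2 * 0)) :=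
      tendsto_one_div_add_atTop_nhds_zero_nat.const_mul 2
    rw [mul_zero] at this
    filter_upwards [this.eventually_lt_const (by positivity : 0 < ε / 4)] with n hn
    calc 2 / ((n : ℝ) + 1) = 2 * (1 / ((n : ℝ) + 1)) := by ring
      _ < _ := hn
  obtain ⟨N, hN⟩ := eventually_atTop.1 (h1.and h2)
  refine ⟨N, fun n hn => ?_⟩
  obtain ⟨hn1, hn2⟩ := hN n hn.le
  have hpos : (0 : ℝ) < n + 1 := by positivity
  have hcard : (Fintype.card (Fin (n + 1)) : ℝ) = n + 1 := by simp
  have hnn : 0 ≤ meanDev (normTensor (H n)) c := integral_nonneg fun _ => abs_nonneg _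
  rw [Real.dist_eq, sub_zero, abs_of_nonneg hnn]
  -- The term `2/(n+1)` pays for the two summands `j = i` and `j = k` that the hypothesis leaves
  -- out.
  refine (meanDev_le (ε := ε / 4 + 2 / (n + 1)) hc (by positivity) fun i k hik => ?_).trans_lt ?_
  · have hsum : |∑ j, (adjTensor (H n) j i k - c)| ≤ ε / 4 * (n + 1) + 2 := by
      refine (abs_sum_le_subtype_ne (fun j => ?_) i k).trans (by linarith [hn1 i k hik])
      have h3 := adjTensor_nonneg (H n) j i k
      have h4 := adjTensor_le_one (H n) j i k
      rw [abs_le]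
      constructor <;> linarith [hc.1, hc.2]
    have heq : (∑ j, adjTensor (H n) j i k) / Fintype.card (Fin (n + 1)) - c =
        (∑ j, (adjTensor (H n) j i k - c)) / (n + 1) := by
      rw [Finset.sum_sub_distrib, hcard]
      simp only [Finset.sum_const, Finset.card_univ, nsmul_eq_mul, hcard]
      field_simp
    rw [heq, abs_div, abs_of_pos hpos, div_le_iff₀ hpos]
    calc |∑ j, (adjTensor (H n) j i k - c)| ≤ ε / 4 * (n + 1) + 2 := hsum
      _ = (ε / 4 + 2 / (n + 1)) * (n + 1) := by field_simp
  · rw [hcard]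
    have : 1 / ((n : ℝ) + 1) ≤ 2 / (n + 1) := by gcongr; norm_num
    linarith

theorem card_offDiag_le (n : ℕ) :
    Fintype.card {q : Fin (n + 1) × Fin (n + 1) // q.1 ≠ q.2} ≤ (n + 1) ^ 2 :=
  (Fintype.card_subtype_le _).trans (by simp [sq])

theorem card_ne_ne_le {n : ℕ} (i k : Fin (n + 1)) :
    Fintype.card {j : Fin (n + 1) // j ≠ i ∧ j ≠ k} ≤ n + 1 :=
  (Fintype.card_subtype_le _).trans (by simp)

variable {Ω : Type*} [MeasurableSpace Ω] (P : Measure Ω)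

/-- Passing from a set of pairs to a graph only discards the diagonal, which the Bernoulli set
avoids almost surely, so the edge set recovers it. -/
theorem hasLaw_edgeSet {V : Type*} [Finite V] {p : I} {G : Ω → SimpleGraph V}
    (hG : HasLaw G (SimpleGraph.binomialRandom V p) P) :
    HasLaw (fun ω => (G ω).edgeSet) (setBernoulli Sym2.diagSetᶜ p) P where
  aemeasurable := SimpleGraph.measurableEmbedding_edgeSet.measurable.comp_aemeasurable
    hG.aemeasurable
  map_eq := by
    have hm := (SimpleGraph.measurableEmbedding_edgeSet (V := V)).measurable
    have h1 : P.map (fun ω => (G ω).edgeSet) = (P.map G).map SimpleGraph.edgeSet :=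
      (AEMeasurable.map_map_of_aemeasurable hm.aemeasurable hG.aemeasurable).symm
    rw [h1, hG.map_eq, SimpleGraph.binomialRandom_eq_map,
      Measure.map_map hm SimpleGraph.measurable_fromEdgeSet]
    conv_rhs => rw [← Measure.map_id (μ := setBernoulli (Sym2.diagSetᶜ : Set (Sym2 V)) p)]
    refine Measure.map_congr ?_
    filter_upwards [setBernoulli_ae_subset (u := (Sym2.diagSetᶜ : Set (Sym2 V))) (p := p)] with S hS
    simp only [Function.comp_apply, SimpleGraph.edgeSet_fromEdgeSet, id]
    ext e
    exact ⟨fun h => h.1, fun h => ⟨h, hS h⟩⟩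

variable [IsProbabilityMeasure P]

/-- For a fixed pair the triples `{j, i, k}` are distinct, so the codegree counts independent events
of probability `1/8`, each block being a single coordinate. -/
theorem ae_tendsto_meanDev_erdosRenyi {H : (n : ℕ) → Ω → Hypergraph (Fin (n + 1))}
    (hH : ∀ n, IsErdosRenyiHypergraph P ⟨1 / 8, by norm_num, by norm_num⟩ 3 (H n)) :
    ∀ᵐ ω ∂P, Tendsto (fun n => meanDev (normTensor (H n ω)) (1 / 8)) atTop (𝓝 0) := by
  have key := ae_eventually_pattern_count P (fun n => (hH n).hasLaw) card_offDiag_le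
    (J := fun n q => {j // j ≠ q.1.1 ∧ j ≠ q.1.2}) (fun n q => card_ne_ne_le _ _) (κ := Unit)
    (fun n q x => {x.1.1, q.1.1, q.1.2}) ?_ ?_ (fun _ _ _ _ => True) (m := 1 / 8) (by simp)
  · filter_upwards [key] with ω hω
    refine tendsto_meanDev (by norm_num) fun ε hε => ?_
    filter_upwards [hω ε hε] with n hn i k hik
    convert hn ⟨(i, k), hik⟩ using 5 with j
    unfold adjTensor
    congr 1
    simp
  · rintro n ⟨⟨i, k⟩, hik⟩ ⟨⟨j, hji, hjk⟩, _⟩ ⟨⟨j', hji', hjk'⟩, _⟩ h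
    have hj : j ∈ ({j', i, k} : Set (Fin (n + 1))) := by
      rw [← show ({j, i, k} : Set (Fin (n + 1))) = {j', i, k} from h]; simp
    simp only [Set.mem_insert_iff, Set.mem_singleton_iff] at hj
    rcases hj with rfl | rfl | rfl
    · rfl
    · exact absurd rfl hji
    · exact absurd rfl hjk
  · rintro n ⟨⟨i, k⟩, hik⟩ ⟨⟨j, hji, hjk⟩, _⟩
    exact Set.ncard_eq_three.2 ⟨j, i, k, hji, hjk, hik, rfl⟩

/-- A pair of vertices in increasing order. -/
def sortPair {V : Type*} [LinearOrder V] (x y : V) : V × V := if x < y then (x, y) else (y, x)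

theorem sortPair_lt {V : Type*} [LinearOrder V] {x y : V} (h : x ≠ y) :
    (sortPair x y).1 < (sortPair x y).2 := by
  unfold sortPair
  split_ifs with hxy
  · exact hxy
  · exact lt_of_le_of_ne (not_lt.1 hxy) h.symm

theorem sortPair_eq {V : Type*} [LinearOrder V] {x y x' y' : V} (h : sortPair x y = sortPair x' y') :
    (x = x' ∧ y = y') ∨ (x = y' ∧ y = x') := by
  unfold sortPair at h
  split_ifs at h <;> simp only [Prod.mk.injEq] at h <;> tauto

/-- The randomness is stored on increasing pairs only. An arbitrary arc is therefore a prescribed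
value, present or absent, of the coordinate at the sorted pair. -/
theorem IsTournament.adj_iff {V : Type*} [LinearOrder V] {D : Digraph V} (hD : IsTournament D)
    {x y : V} (h : x ≠ y) :
    D.Adj x y ↔ (sortPair x y ∈ {e : V × V | e.1 < e.2 ∧ D.Adj e.1 e.2} ↔ x < y) := by
  have h1 := sortPair_lt h
  simp only [Set.mem_ofPred_eq, h1, true_and]
  unfold sortPair
  split_ifs with hxy
  · simp [hxy]
  · have := hD.2 x y h
    simp only [hxy, iff_false]
    rw [xor_iff_iff_not] at this
    exact this

theorem ae_tendsto_meanDev_tournament {D : (n : ℕ) → Ω → Digraph (Fin (n + 1))}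
    (hD : ∀ n, IsRandomTournament P (D n)) :
    ∀ᵐ ω ∂P, Tendsto (fun n => meanDev (normTensor (cycleHypergraph (D n ω))) (1 / 4)) atTop
      (𝓝 0) := by
  -- The block of `j` for the ordered pair `(i,k)` consists of the coordinates deciding `k → j`
  -- (`true`) and `j → i` (`false`). Whatever the order of the vertices, the required pattern has
  -- probability `1/2 · 1/2`. The count is controlled for every ordered pair, so no conditioning on
  -- `i → k` is needed.
  have key := ae_eventually_pattern_count P (fun n => (hD n).hasLaw) card_offDiag_le
    (J := fun n q => {j // j ≠ q.1.1 ∧ j ≠ q.1.2}) (fun n q => card_ne_ne_le _ _) (κ := Bool)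
    (fun n q x => if x.2 then sortPair q.1.2 x.1.1 else sortPair x.1.1 q.1.1) ?_ ?_
    (fun n q j b => if b then q.1.2 < j.1 else j.1 < q.1.1) (m := 1 / 4) ?_
  · filter_upwards [key] with ω hω
    refine tendsto_meanDev (by norm_num) fun ε hε => ?_
    filter_upwards [hω ε hε] with n hn
    have hT := (hD n).tournament ω
    have main : ∀ i k : Fin (n + 1), i ≠ k → (D n ω).Adj i k →
        |∑ j : {j // j ≠ i ∧ j ≠ k},
          (adjTensor (cycleHypergraph (D n ω)) j i k - 1 / 4)| < ε * (n + 1) := by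
      intro i k hik hadj
      convert hn ⟨(i, k), hik⟩ using 5 with j
      unfold adjTensor
      congr 1
      rw [eq_iff_iff, cycleHypergraph_edge_iff hT hadj j.2.1 j.2.2,
        hT.adj_iff j.2.2.symm, hT.adj_iff j.2.1]
      simp [Bool.forall_bool, and_comm]
    -- If the arc goes from `k` to `i`, the symmetry of the tensor exchanges the two vertices.
    intro i k hik
    rcases (hT.2 i k hik).or with h | h
    · exact main i k hik h
    · have h1 := main k i hik.symm h
      have h2 : ∑ j : {j // j ≠ i ∧ j ≠ k}, (adjTensor (cycleHypergraph (D n ω)) j i k - 1 / 4) =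
          ∑ j : {j // j ≠ k ∧ j ≠ i}, (adjTensor (cycleHypergraph (D n ω)) j k i - 1 / 4) := by
        refine Fintype.sum_equiv (Equiv.subtypeEquivRight fun j => and_comm) _ _ fun j => ?_
        rw [adjTensor_swap]
        rfl
      rwa [h2]
  · rintro n ⟨⟨i, k⟩, hik⟩ ⟨⟨j, hji, hjk⟩, b⟩ ⟨⟨j', hji', hjk'⟩, b'⟩ h
    simp only at hik hji hjk hji' hjk' h
    cases b <;> cases b' <;> simp only [if_true, if_false, Bool.false_eq_true] at h <;>
      rcases sortPair_eq h with ⟨h1, h2⟩ | ⟨h1, h2⟩ <;> subst_vars <;>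
      first | rfl | exact absurd rfl ‹_›
  · rintro n ⟨⟨i, k⟩, hik⟩ ⟨⟨j, hji, hjk⟩, b⟩
    cases b
    · exact sortPair_lt hji
    · exact sortPair_lt (Ne.symm hjk)
  · intro n q j
    norm_num [Fintype.prod_bool]

/-- At a non-edge of the graph the codegree is zero and the deviation equals `c`. By concentration
at each vertex, eventually at least a quarter of the ordered pairs are non-edges. -/
theorem ae_le_meanDev_triangle {G : (n : ℕ) → Ω → SimpleGraph (Fin (n + 1))}
    (hG : ∀ n, HasLaw (G n)
      (SimpleGraph.binomialRandom (Fin (n + 1)) ⟨1 / 2, by norm_num, by norm_num⟩) P) :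
    ∀ᵐ ω ∂P, ∀ᶠ n in atTop, ∀ c : ℝ, 0 ≤ c →
      c / 4 ≤ meanDev (normTensor (triangleHypergraph (G n ω))) c := by
  classical
  have key := ae_eventually_pattern_count P (fun n => hasLaw_edgeSet P (hG n))
    (Q := fun n => Fin (n + 1)) (fun n => by rw [Fintype.card_fin, sq]; exact Nat.le_mul_self _)
    (J := fun n i => {k // k ≠ i}) (fun n i => (Fintype.card_subtype_le _).trans (by simp))
    (κ := Unit) (fun n i x => s(i, x.1.1)) ?_ ?_ (fun _ _ _ _ => False) (m := 1 / 2)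
    (by norm_num)
  · filter_upwards [key] with ω hω
    -- A vertex has at least `n/2 - (n+1)/8` non-neighbours other than itself, and this is at least
    -- `(n+1)/4` exactly when `n ≥ 3`.
    filter_upwards [hω (1 / 8) (by norm_num), eventually_ge_atTop 3] with n hn hn3 c hc
    have hcard : (Fintype.card (Fin (n + 1)) : ℝ) = n + 1 := by simp
    have hn3' : (3 : ℝ) ≤ n := by exact_mod_cast hn3
    have hrow : ∀ i : Fin (n + 1), c * ((n + 1) / 4) ≤
        ∑ k, |twoAction (normTensor (triangleHypergraph (G n ω))) (fun _ => 1) (fun _ => 1)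
          (.mk i k) - c| := by
      intro i
      have h1 := (abs_lt.1 (hn i)).1
      rw [Finset.sum_sub_distrib] at h1
      simp only [Finset.sum_const, Finset.card_univ, nsmul_eq_mul, forall_const, iff_false,
        SimpleGraph.mem_edgeSet, Fintype.card_subtype_compl, Fintype.card_fin, Fintype.card_unique,
        Nat.add_sub_cancel] at h1
      have h2 : (n + 1 : ℝ) / 4 ≤ ∑ k : {k // k ≠ i}, if ¬ (G n ω).Adj i k then (1 : ℝ) else 0 := by
        linarith
      calc c * ((n + 1) / 4)
          ≤ c * ∑ k : {k // k ≠ i}, if ¬ (G n ω).Adj i k then (1 : ℝ) else 0 := by gcongr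
        _ = ∑ k : {k // k ≠ i}, c * if ¬ (G n ω).Adj i k then (1 : ℝ) else 0 := Finset.mul_sum _ _ _
        _ ≤ ∑ k : {k // k ≠ i}, |twoAction (normTensor (triangleHypergraph (G n ω))) (fun _ => 1)
              (fun _ => 1) (.mk i k.1) - c| := by
            refine Finset.sum_le_sum fun k _ => ?_
            by_cases h : (G n ω).Adj i k
            swap
            · rw [twoAction_normTensor_one, Finset.sum_eq_zero fun j _ =>
                adjTensor_triangleHypergraph_eq_zero k.2.symm h j]
              simp [abs_of_nonneg hc, h]
            · simp [h]
        _ = ∑ k ∈ Finset.univ.filter (· ≠ i), |twoAction (normTensor (triangleHypergraph (G n ω)))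
              (fun _ => 1) (fun _ => 1) (.mk i k) - c| :=
            (Finset.sum_subtype (p := fun k => k ≠ i) _ (by simp) (fun k => |twoAction (normTensor
              (triangleHypergraph (G n ω))) (fun _ => 1) (fun _ => 1) (.mk i k) - c|)).symm
        _ ≤ _ := Finset.sum_le_univ_sum_of_nonneg fun _ => abs_nonneg _
    rw [meanDev_eq, hcard]
    have hsum := Finset.sum_le_sum fun i (_ : i ∈ Finset.univ) => hrow i
    simp only [Finset.sum_const, Finset.card_univ, nsmul_eq_mul, hcard] at hsum
    calc c / 4 = (((n : ℝ) + 1) ^ 2)⁻¹ * ((n + 1) * (c * ((n + 1) / 4))) := by field_simp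
      _ ≤ _ := by gcongr
  · rintro n i ⟨⟨k, hk⟩, _⟩ ⟨⟨k', hk'⟩, _⟩ h
    have h : s(i, k) = s(i, k') := h
    have := Sym2.congr_right.1 h
    subst this
    rfl
  · rintro n i ⟨⟨k, hk⟩, _⟩
    exact fun h => hk.symm (Sym2.mem_diagSet.1 h)

end RandomCodegree

/-! ### Lévy–Prokhorov estimates -/

section LevyProkhorov

variable {Ω : Type*} [MeasurableSpace Ω] {μ : Measure Ω}

/-- Both laws live on one probability space: if `X` lies in `B`, then `Y` lies in the thickening of
`B` outside an event of measure at most `ε`. -/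
theorem levyProkhorovEDist_map_le {E : Type*} [PseudoEMetricSpace E] [MeasurableSpace E]
    [OpensMeasurableSpace E] {X Y : Ω → E} (hX : Measurable X) (hY : Measurable Y) {ε : ℝ≥0∞}
    (h : μ {x | ε ≤ edist (X x) (Y x)} ≤ ε) :
    levyProkhorovEDist (μ.map X) (μ.map Y) ≤ ε := by
  have key : ∀ {X Y : Ω → E}, Measurable X → Measurable Y →
      μ {x | ε ≤ edist (X x) (Y x)} ≤ ε → ∀ (δ : ℝ≥0∞) (B : Set E), ε < δ → δ < ∞ →
      MeasurableSet B → μ.map X B ≤ μ.map Y (Metric.thickening δ.toReal B) + δ := by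
    intro X Y hX hY h δ B hδ hδt hB
    rw [Measure.map_apply hX hB, Measure.map_apply hY Metric.isOpen_thickening.measurableSet]
    calc μ (X ⁻¹' B) ≤ μ (Y ⁻¹' Metric.thickening δ.toReal B ∪ {x | ε ≤ edist (X x) (Y x)}) := by
          refine measure_mono fun x hx => ?_
          by_cases hxy : ε ≤ edist (X x) (Y x)
          · exact Or.inr hxy
          · refine Or.inl ?_
            change Metric.infEDist (Y x) B < ENNReal.ofReal δ.toReal
            rw [ENNReal.ofReal_toReal hδt.ne]
            refine (Metric.infEDist_le_edist_of_mem (show X x ∈ B from hx)).trans_lt ?_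
            rw [edist_comm]
            exact (not_le.1 hxy).trans hδ
      _ ≤ _ := measure_union_le _ _
      _ ≤ _ := by gcongr; exact h.trans hδ.le
  refine levyProkhorovEDist_le_of_forall _ _ _ fun δ B hδ hδt hB =>
    ⟨key hX hY h δ B hδ hδt hB, key hY hX ?_ δ B hδ hδt hB⟩
  simpa only [edist_comm] using h

variable [IsProbabilityMeasure μ]

theorem norm_le_sum_abs {ι : Type*} [Fintype ι] (x : EuclideanSpace ℝ ι) : ‖x‖ ≤ ∑ p, |x p| := by
  rw [EuclideanSpace.norm_eq]
  refine Real.sqrt_le_iff.2 ⟨Finset.sum_nonneg fun _ _ => abs_nonneg _, ?_⟩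
  exact Finset.sum_sq_le_sq_sum_of_nonneg fun _ _ => norm_nonneg _

/-- Markov's inequality: an `L¹` distance of at most `ε²` leaves measure at most `ε` to the event
that the distance reaches `ε`. -/
theorem levyProkhorovEDist_map_le_of_integral {ι : Type*} [Fintype ι]
    {X Y : Ω → EuclideanSpace ℝ ι} (hX : Measurable X) (hY : Measurable Y)
    (hI : ∀ p, Integrable (fun x => X x p - Y x p) μ) {ε : ℝ} (hε : 0 < ε)
    (h : ∑ p, ∫ x, |X x p - Y x p| ∂μ ≤ ε ^ 2) :
    levyProkhorovEDist (μ.map X) (μ.map Y) ≤ ENNReal.ofReal ε := by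
  refine levyProkhorovEDist_map_le hX hY ?_
  have hint : Integrable (fun x => ∑ p, |X x p - Y x p|) μ :=
    integrable_finsetSum _ fun p _ => (hI p).abs
  have h1 := mul_meas_ge_le_integral_of_nonneg (μ := μ)
    (Eventually.of_forall fun x => Finset.sum_nonneg fun p _ => abs_nonneg (X x p - Y x p)) hint ε
  rw [integral_finsetSum _ fun p _ => (hI p).abs] at h1
  have h2 : μ.real {x | ε ≤ ∑ p, |X x p - Y x p|} ≤ ε := by
    have : ε * μ.real {x | ε ≤ ∑ p, |X x p - Y x p|} ≤ ε * ε := by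
      rw [← sq]; exact h1.trans h
    exact le_of_mul_le_mul_left this hε
  have h3 : {x | ENNReal.ofReal ε ≤ edist (X x) (Y x)} ⊆ {x | ε ≤ ∑ p, |X x p - Y x p|} := by
    intro x hx
    have hx : ENNReal.ofReal ε ≤ edist (X x) (Y x) := hx
    rw [edist_dist, ENNReal.ofReal_le_ofReal_iff dist_nonneg, dist_eq_norm] at hx
    exact hx.trans (norm_le_sum_abs _)
  refine (measure_mono h3).trans ?_
  rw [← ENNReal.ofReal_toReal (measure_ne_top μ _)]
  exact ENNReal.ofReal_le_ofReal h2

theorem integral_le_of_measureReal_le {h : Ω → ℝ} (hm : AEStronglyMeasurable h μ) {G : Set Ω}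
    (hG : MeasurableSet G) {a M ε : ℝ} (ha : 0 ≤ a) (hM : ∀ x, |h x| ≤ M)
    (hGa : ∀ x ∈ G, h x ≤ a) (hε : μ.real Gᶜ ≤ ε) : ∫ x, h x ∂μ ≤ a + M * ε := by
  have hM0 : 0 ≤ M := by
    obtain ⟨x⟩ := nonempty_of_isProbabilityMeasure μ
    exact (abs_nonneg _).trans (hM x)
  have hi : Integrable (Gᶜ.indicator fun _ => M) μ := (integrable_const M).indicator hG.compl
  calc ∫ x, h x ∂μ ≤ ∫ x, (a + Gᶜ.indicator (fun _ => M) x) ∂μ := by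
        refine integral_mono (Integrable.of_bound hm M (Eventually.of_forall hM))
          ((integrable_const a).add hi) fun x => ?_
        by_cases hx : x ∈ G
        · simpa [hx] using hGa x hx
        · have := (abs_le.1 (hM x)).2
          simp only [Set.mem_compl_iff, hx, not_false_eq_true, Set.indicator_of_mem]
          linarith
    _ = a + M * μ.real Gᶜ := by
        rw [integral_add (integrable_const a) hi, integral_indicator_const _ hG.compl]
        simp [mul_comm]
    _ ≤ _ := by gcongr

end LevyProkhorov

/-! ### Estimates for 2-actions -/

section TwoAction

variable {V : Type*}

/-- The preimage of a singleton is an invariant set. -/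
theorem symm_of_measurable {f : SymPair V → ℝ} (hf : Measurable f) (i k : V) :
    f (.mk i k) = f (.mk k i) :=
  ((measurableSet_symPair.1 (hf (measurableSet_singleton (f (.mk k i))))) i k).2 rfl

variable [Fintype V]

theorem twoAction_add_left (T : V → V → V → ℝ) (f f' g : SymPair V → ℝ) :
    twoAction T (f + f') g = twoAction T f g + twoAction T f' g := by
  funext x
  simp only [twoAction, Pi.add_apply, mul_add, add_mul, Finset.sum_add_distrib]
  ring

theorem twoAction_add_right (T : V → V → V → ℝ) (f g g' : SymPair V → ℝ) :
    twoAction T f (g + g') = twoAction T f g + twoAction T f g' := by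
  funext x
  simp only [twoAction, Pi.add_apply, mul_add, Finset.sum_add_distrib]
  ring

theorem twoAction_smul_left (T : V → V → V → ℝ) (c : ℝ) (f g : SymPair V → ℝ) :
    twoAction T (c • f) g = c • twoAction T f g := by
  funext x
  simp only [twoAction, Pi.smul_apply, smul_eq_mul, mul_add, Finset.mul_sum]
  congr 1 <;> exact Finset.sum_congr rfl fun _ _ => by ring

theorem twoAction_smul_right (T : V → V → V → ℝ) (c : ℝ) (f g : SymPair V → ℝ) :
    twoAction T f (c • g) = c • twoAction T f g := by
  funext x
  simp only [twoAction, Pi.smul_apply, smul_eq_mul, mul_add, Finset.mul_sum]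
  congr 1 <;> exact Finset.sum_congr rfl fun _ _ => by ring

theorem measurable_twoAction (T : V → V → V → ℝ) (f g : SymPair V → ℝ) :
    Measurable (twoAction T f g) :=
  measurable_of_symm (twoAction_symm T f g)

theorem integrable_unif [Nonempty V] {h : SymPair V → ℝ} (hm : Measurable h) :
    Integrable h (unif V) := by
  obtain ⟨C, hC⟩ := (Set.finite_range fun x => ‖h x‖).bddAbove
  exact Integrable.of_bound hm.aestronglyMeasurable C
    (Eventually.of_forall fun x => hC ⟨x, rfl⟩)

variable [Nonempty V] {T : V → V → V → ℝ}

theorem abs_twoAction_le (hT : ∀ i j k, |T i j k| ≤ 1 / (Fintype.card V : ℝ))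
    {f g : SymPair V → ℝ} {a b : ℝ} (hf : ∀ x, |f x| ≤ a) (hg : ∀ x, |g x| ≤ b) (x : SymPair V) :
    |twoAction T f g x| ≤ a * b := by
  have ha : 0 ≤ a := (abs_nonneg _).trans (hf x)
  have hN : (0 : ℝ) < Fintype.card V := by exact_mod_cast Fintype.card_pos
  have key : ∀ i k : V, |∑ j, T j i k * f (.mk j i) * g (.mk j k)| ≤ a * b := by
    intro i k
    calc |∑ j, T j i k * f (.mk j i) * g (.mk j k)|
        ≤ ∑ j, |T j i k * f (.mk j i) * g (.mk j k)| := Finset.abs_sum_le_sum_abs _ _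
      _ ≤ ∑ _j : V, 1 / (Fintype.card V : ℝ) * a * b := by
          refine Finset.sum_le_sum fun j _ => ?_
          rw [abs_mul, abs_mul]
          gcongr
          exacts [hT _ _ _, hf _, hg _]
      _ = a * b := by
          simp only [Finset.sum_const, Finset.card_univ, nsmul_eq_mul]
          field_simp
  have h1 := abs_le.1 (key x.fst x.snd)
  have h2 := abs_le.1 (key x.snd x.fst)
  simp only [twoAction]
  rw [abs_le]
  constructor <;> linarith [h1.1, h1.2, h2.1, h2.2]

/-- Cauchy–Schwarz over the triples `(i,k,j)`. The bound does not depend on the number of vertices;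
it gives both the stability of `T₂[1,1]` under `L²` perturbations and the extension of the limit
operator. -/
theorem integral_abs_twoAction_le (hT : ∀ i j k, |T i j k| ≤ 1 / (Fintype.card V : ℝ))
    {f g : SymPair V → ℝ} (hf : Measurable f) (hg : Measurable g) :
    ∫ x, |twoAction T f g x| ∂(unif V) ≤
      √(∫ x, f x ^ 2 ∂(unif V)) * √(∫ x, g x ^ 2 ∂(unif V)) := by
  have hN : (0 : ℝ) < Fintype.card V := by exact_mod_cast Fintype.card_pos
  set N : ℝ := (Fintype.card V : ℝ) with hNdef
  have hfs := symm_of_measurable hf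
  have hgs := symm_of_measurable hg
  rw [integral_unif (h := fun x => |twoAction T f g x|) fun i k => by rw [twoAction_symm],
    integral_unif (h := fun x => f x ^ 2) fun i k => by rw [hfs],
    integral_unif (h := fun x => g x ^ 2) fun i k => by rw [hgs]]
  set F := ∑ i, ∑ k, f (.mk i k) ^ 2
  set G := ∑ i, ∑ k, g (.mk i k) ^ 2
  have hF : 0 ≤ F := Finset.sum_nonneg fun _ _ => Finset.sum_nonneg fun _ _ => sq_nonneg _
  set S := ∑ i, ∑ k, ∑ j, |f (.mk j i)| * |g (.mk j k)|
  have hS0 : 0 ≤ S := Finset.sum_nonneg fun _ _ => Finset.sum_nonneg fun _ _ =>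
    Finset.sum_nonneg fun _ _ => by positivity
  have hpt : ∀ i k, |twoAction T f g (.mk i k)| ≤ (1 / (2 * N)) *
      (∑ j, |f (.mk j i)| * |g (.mk j k)| + ∑ j, |f (.mk j k)| * |g (.mk j i)|) := by
    have key : ∀ i k : V, |∑ j, T j i k * f (.mk j i) * g (.mk j k)| ≤
        1 / N * ∑ j, |f (.mk j i)| * |g (.mk j k)| := by
      intro i k
      rw [Finset.mul_sum]
      refine (Finset.abs_sum_le_sum_abs _ _).trans (Finset.sum_le_sum fun j _ => ?_)
      rw [abs_mul, abs_mul, mul_assoc]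
      gcongr
      exact hT _ _ _
    intro i k
    have h0 : twoAction T f g (.mk i k) = (1 / 2 : ℝ) *
      (∑ j, T j i k * f (.mk j i) * g (.mk j k) + ∑ j, T j k i * f (.mk j k) * g (.mk j i)) := rfl
    rw [h0, abs_mul, abs_of_pos (by norm_num : (0 : ℝ) < 1 / 2)]
    calc (1 / 2 : ℝ) * |∑ j, T j i k * f (.mk j i) * g (.mk j k) +
          ∑ j, T j k i * f (.mk j k) * g (.mk j i)|
        ≤ 1 / 2 * (1 / N * ∑ j, |f (.mk j i)| * |g (.mk j k)| +
            1 / N * ∑ j, |f (.mk j k)| * |g (.mk j i)|) := by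
          gcongr
          exact (abs_add_le _ _).trans (add_le_add (key i k) (key k i))
      _ = _ := by field_simp
  have hsum : ∑ i, ∑ k, |twoAction T f g (.mk i k)| ≤ S / N := by
    calc ∑ i, ∑ k, |twoAction T f g (.mk i k)|
        ≤ ∑ i, ∑ k, (1 / (2 * N)) *
          (∑ j, |f (.mk j i)| * |g (.mk j k)| + ∑ j, |f (.mk j k)| * |g (.mk j i)|) :=
          Finset.sum_le_sum fun i _ => Finset.sum_le_sum fun k _ => hpt i k
      _ = 1 / (2 * N) * (S + ∑ i, ∑ k, ∑ j, |f (.mk j k)| * |g (.mk j i)|) := by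
          simp only [S, ← Finset.mul_sum, Finset.sum_add_distrib]
      _ = 1 / (2 * N) * (S + S) := by
          rw [Finset.sum_comm (f := fun i k => ∑ j, |f (.mk j k)| * |g (.mk j i)|)]
      _ = S / N := by field_simp; ring
  -- Each squared factor ignores one of the three vertices, hence the two factors `N`.
  have hCS : S ^ 2 ≤ (N * F) * (N * G) := by
    have h1 := Finset.sum_mul_sq_le_sq_mul_sq (Finset.univ : Finset (V × V × V))
      (fun p => |f (.mk p.2.2 p.1)|) (fun p => |g (.mk p.2.2 p.2.1)|)
    simp only [Fintype.sum_prod_type, sq_abs] at h1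
    refine h1.trans (le_of_eq ?_)
    congr 1
    · simp only [F, Finset.sum_const, Finset.card_univ, nsmul_eq_mul, ← Finset.mul_sum]
      congr 1
      exact Finset.sum_comm
    · simp only [G, Finset.sum_const, Finset.card_univ, nsmul_eq_mul]
      congr 1
      exact Finset.sum_comm
  have hS : S ≤ N * (√F * √G) := by
    rw [← Real.sqrt_mul hF]
    refine abs_le_of_sq_le_sq' ?_ (by positivity) |>.2
    rw [mul_pow, Real.sq_sqrt (mul_nonneg hF
      (Finset.sum_nonneg fun _ _ => Finset.sum_nonneg fun _ _ => sq_nonneg _))]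
    exact hCS.trans (le_of_eq (by ring))
  rw [Real.sqrt_mul (by positivity), Real.sqrt_mul (by positivity)]
  calc (N ^ 2)⁻¹ * ∑ i, ∑ k, |twoAction T f g (.mk i k)|
      ≤ (N ^ 2)⁻¹ * (√F * √G) := by
        gcongr
        refine hsum.trans ?_
        rw [div_le_iff₀ hN]
        linarith
    _ = √((N ^ 2)⁻¹) * √F * (√((N ^ 2)⁻¹) * √G) := by
        have := Real.mul_self_sqrt (by positivity : 0 ≤ (N ^ 2)⁻¹)
        calc (N ^ 2)⁻¹ * (√F * √G) = √((N ^ 2)⁻¹) * √((N ^ 2)⁻¹) * (√F * √G) := by rw [this]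
          _ = _ := by ring

/-- Functions close to one whose image is close to `c` force `T₂[1,1]` to be close to `c`. -/
theorem meanDev_le_of_close (hT : ∀ i j k, |T i j k| ≤ 1 / (Fintype.card V : ℝ))
    {f g : SymPair V → ℝ} (hf : Measurable f) (hg : Measurable g) (hf1 : ∀ x, |f x| ≤ 1)
    (hg1 : ∀ x, |g x| ≤ 1) {c ε : ℝ} (hc : |c| ≤ 1) (hε0 : 0 ≤ ε) (hε : ε ≤ 1)
    {G : Set (SymPair V)} (hG : MeasurableSet G) (hGε : (unif V).real Gᶜ ≤ ε)
    (hGf : ∀ x ∈ G, |f x - 1| ≤ ε) (hGg : ∀ x ∈ G, |g x - 1| ≤ ε)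
    (hGc : ∀ x ∈ G, |twoAction T f g x - c| ≤ ε) :
    meanDev T c ≤ 2 * √(5 * ε) + 3 * ε := by
  have hsq : ∀ {u : SymPair V → ℝ}, Measurable u → (∀ x, |u x| ≤ 1) → (∀ x ∈ G, |u x - 1| ≤ ε) →
      ∫ x, (u x - 1) ^ 2 ∂(unif V) ≤ 5 * ε := by
    intro u hu hu1 huG
    -- The square is at most `ε² ≤ ε` on `G` and at most `4` elsewhere, in total `ε + 4ε`.
    refine (integral_le_of_measureReal_le (by fun_prop) hG hε0 (M := 4) (fun x => ?_)
      (fun x hx => ?_) hGε).trans (by linarith)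
    · have := abs_le.1 (hu1 x)
      rw [abs_of_nonneg (sq_nonneg _)]
      nlinarith
    · have := huG x hx
      rw [← sq_abs]
      nlinarith [abs_nonneg (u x - 1)]
  have hone : ∀ {u : SymPair V → ℝ}, Measurable u → (∀ x, |u x| ≤ 1) →
      √(∫ x, u x ^ 2 ∂(unif V)) ≤ 1 := by
    intro u hu hu1
    rw [Real.sqrt_le_one]
    calc ∫ x, u x ^ 2 ∂(unif V) ≤ ∫ _x, (1 : ℝ) ∂(unif V) := by
          refine integral_mono (integrable_unif (by fun_prop)) (integrable_const _) fun x => ?_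
          exact (sq_le_one_iff_abs_le_one _).2 (hu1 x)
      _ = 1 := by simp
  have hfm : Measurable fun x => f x - 1 := hf.sub_const 1
  have hgm : Measurable fun x => g x - 1 := hg.sub_const 1
  have h1 := integral_abs_twoAction_le hT hfm hg
  have h2 := integral_abs_twoAction_le hT (f := fun _ => 1) measurable_const hgm
  have h3 : ∫ x, |twoAction T f g x - c| ∂(unif V) ≤ 3 * ε := by
    have hm := measurable_twoAction T f g
    refine (integral_le_of_measureReal_le (by fun_prop) hG hε0 (M := 2) (fun x => ?_)
      (fun x hx => hGc x hx) hGε).trans (by linarith)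
    rw [abs_abs]
    have := abs_twoAction_le hT hf1 hg1 x
    exact (abs_sub _ _).trans (by linarith)
  have h4 : √(∫ x, (f x - 1) ^ 2 ∂(unif V)) ≤ √(5 * ε) := Real.sqrt_le_sqrt (hsq hf hf1 hGf)
  have h5 : √(∫ x, (g x - 1) ^ 2 ∂(unif V)) ≤ √(5 * ε) := Real.sqrt_le_sqrt (hsq hg hg1 hGg)
  have h6 := hone hg hg1
  have h7 := hone (u := fun _ => (1 : ℝ)) measurable_const (fun x => by simp)
  -- The arguments are replaced by `1` one at a time; each replacement costs at most `√(5ε)` in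
  -- `L¹`.
  have hdec : twoAction T f g = twoAction T (fun x => f x - 1) g +
      (twoAction T (fun _ => 1) (fun x => g x - 1) +
        twoAction T (fun _ => 1) (fun _ => 1)) := by
    have e1 : f = (fun x => f x - 1) + fun _ => 1 := by funext x; simp
    have e2 : g = (fun x => g x - 1) + fun _ => 1 := by funext x; simp
    conv_lhs => rw [e1, twoAction_add_left]
    rw [← twoAction_add_right, ← e2]
  have hle : ∀ x, |twoAction T (fun _ => 1) (fun _ => 1) x - c| ≤
      |twoAction T (fun x => f x - 1) g x| + |twoAction T (fun _ => 1) (fun x => g x - 1) x| +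
        |twoAction T f g x - c| := by
    intro x
    have hx := congrFun hdec x
    simp only [Pi.add_apply] at hx
    have : twoAction T (fun _ => 1) (fun _ => 1) x - c = -twoAction T (fun x => f x - 1) g x +
      -twoAction T (fun _ => 1) (fun x => g x - 1) x + (twoAction T f g x - c) := by
      rw [hx]; ring
    rw [this]
    refine (abs_add_le _ _).trans (add_le_add_left ((abs_add_le _ _).trans ?_) _)
    rw [abs_neg, abs_neg]
  have hi1 := (integrable_unif (measurable_twoAction T (fun x => f x - 1) g)).abs
  have hi2 := (integrable_unif (measurable_twoAction T (fun _ => 1) (fun x => g x - 1))).abs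
  have hi3 : Integrable (fun x => |twoAction T f g x - c|) (unif V) :=
    ((integrable_unif (measurable_twoAction T f g)).sub (integrable_const c)).abs
  have hi4 : Integrable (fun x => |twoAction T (fun _ => 1) (fun _ => 1) x - c|) (unif V) :=
    ((integrable_unif (measurable_twoAction T (fun _ => 1) (fun _ => 1))).sub
      (integrable_const c)).abs
  have hi12 : Integrable (fun x => |twoAction T (fun x => f x - 1) g x| +
      |twoAction T (fun _ => 1) (fun x => g x - 1) x|) (unif V) := hi1.add hi2
  calc meanDev T c ≤ ∫ x, (|twoAction T (fun x => f x - 1) g x| +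
        |twoAction T (fun _ => 1) (fun x => g x - 1) x| + |twoAction T f g x - c|) ∂(unif V) :=
        integral_mono hi4 (hi12.add hi3) hle
    _ = ∫ x, |twoAction T (fun x => f x - 1) g x| ∂(unif V) +
        ∫ x, |twoAction T (fun _ => 1) (fun x => g x - 1) x| ∂(unif V) +
        ∫ x, |twoAction T f g x - c| ∂(unif V) := by
        rw [integral_add hi12 hi3, integral_add hi1 hi2]
    _ ≤ √(5 * ε) * 1 + 1 * √(5 * ε) + 3 * ε := by
        gcongr
        · exact h1.trans (by gcongr)
        · exact h2.trans (by gcongr)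
    _ = _ := by ring

end TwoAction

/-! ### Convergence of the laws of `(1,1,A[1,1])` and different limits -/

section DifferentLimits

theorem MultiPOp.one_mem_unitFun (A : MultiPOp.{u}) : A.one ∈ A.unitFun := by
  have h : ∀ᵐ x ∂A.μ, A.one x = 1 := Lp.coeFn_const ..
  change ∀ᵐ x ∂A.μ, A.one x ∈ Set.Icc (-1 : ℝ) 1
  filter_upwards [h] with x hx
  rw [hx]
  norm_num

theorem MultiPOp.law_mem_profile (A : MultiPOp.{u}) {k : ℕ} {f g : Fin k → Lp ℝ ∞ A.μ}
    (hf : ∀ i, f i ∈ A.unitFun) (hg : ∀ i, g i ∈ A.unitFun) :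
    LevyProkhorov.ofMeasure (A.law f g) ∈ A.profile k :=
  ⟨f, g, hf, hg, rfl⟩

theorem sum_fin_prod_three {k : ℕ} (F : Fin k × Fin 3 → ℝ) :
    ∑ p, F p = ∑ i, (F (i, 0) + F (i, 1) + F (i, 2)) := by
  rw [Fintype.sum_prod_type]
  exact Finset.sum_congr rfl fun i _ => Fin.sum_univ_three _

variable {V : Type u} [Fintype V]

/-- The random vector `(f_1, g_1, T₂[f_1,g_1], …, f_k, g_k, T₂[f_k,g_k])`. -/
noncomputable def tensorVec (T : V → V → V → ℝ) {k : ℕ} (f g : Fin k → SymPair V → ℝ)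
    (x : SymPair V) : EuclideanSpace ℝ (Fin k × Fin 3) :=
  WithLp.toLp 2 fun p => ![f p.1 x, g p.1 x, twoAction T (f p.1) (g p.1) x] p.2

theorem measurable_tensorVec {T : V → V → V → ℝ} {k : ℕ} {f g : Fin k → SymPair V → ℝ}
    (hf : ∀ i, Measurable (f i)) (hg : ∀ i, Measurable (g i)) : Measurable (tensorVec T f g) := by
  refine (WithLp.measurable_toLp 2 (Fin k × Fin 3 → ℝ)).comp (measurable_pi_lambda _ ?_)
  rintro ⟨i, c⟩
  fin_cases c
  · exact hf i
  · exact hg i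
  · exact measurable_twoAction _ _ _

variable [Nonempty V] {T : V → V → V → ℝ}

theorem twoActionOp_vec {k : ℕ} (f g : Fin k → Lp ℝ ∞ (unif V)) :
    (twoActionOp T).vec f g = tensorVec T (fun i => f i) (fun i => g i) := by
  funext x
  unfold MultiPOp.vec tensorVec
  congr 1
  funext p
  have h := twoActionOp_apply T (f p.1) (g p.1) x
  rw [← h]
  rfl

/-- Null sets of the uniform measure are empty, so classes in `L^∞` are genuine symmetric functions
and the bounds hold at every point. -/
theorem mem_profile_twoActionOp {k : ℕ}
    {ν : LevyProkhorov (ProbabilityMeasure (EuclideanSpace ℝ (Fin k × Fin 3)))} :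
    ν ∈ (twoActionOp T).profile k ↔ ∃ f g : Fin k → SymPair V → ℝ, (∀ i, Measurable (f i)) ∧
      (∀ i, Measurable (g i)) ∧ (∀ i x, |f i x| ≤ 1) ∧ (∀ i x, |g i x| ≤ 1) ∧
      (ν.toMeasure : Measure (EuclideanSpace ℝ (Fin k × Fin 3))) =
        (unif V).map (tensorVec T f g) := by
  constructor
  · rintro ⟨f, g, hf, hg, rfl⟩
    have hle : ∀ u : Lp ℝ ∞ (unif V), u ∈ (twoActionOp T).unitFun → ∀ x, |u x| ≤ 1 := fun u hu x =>
      abs_le.2 (forall_of_ae (V := V) (p := fun x => u x ∈ Set.Icc (-1 : ℝ) 1) hu x)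
    refine ⟨fun i => (f i : Lp ℝ ∞ (unif V)), fun i => (g i : Lp ℝ ∞ (unif V)),
      fun i => (Lp.stronglyMeasurable (f i)).measurable,
      fun i => (Lp.stronglyMeasurable (g i)).measurable,
      fun i => hle _ (hf i), fun i => hle _ (hg i), ?_⟩
    exact congrArg (fun v => (unif V).map v) (twoActionOp_vec (T := T) f g)
  · rintro ⟨f, g, hfm, hgm, hf, hg, hν⟩
    have hLp : ∀ {u : SymPair V → ℝ}, Measurable u → (∀ x, |u x| ≤ 1) →
        ∃ U : Lp ℝ ∞ (unif V), U ∈ (twoActionOp T).unitFun ∧ (U : SymPair V → ℝ) = u := by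
      intro u hu hu1
      have hmem : MemLp u ∞ (unif V) :=
        memLp_top_of_bound hu.aestronglyMeasurable 1 (Eventually.of_forall hu1)
      have heq : (hmem.toLp : SymPair V → ℝ) = u := funext fun x => forall_of_ae hmem.coeFn_toLp x
      refine ⟨hmem.toLp, ?_, heq⟩
      change ∀ᵐ x ∂(unif V), (hmem.toLp : SymPair V → ℝ) x ∈ Set.Icc (-1 : ℝ) 1
      rw [heq]
      exact Eventually.of_forall fun x => abs_le.1 (hu1 x)
    choose F hF hFf using fun i => hLp (hfm i) (hf i)
    choose G hG hGg using fun i => hLp (hgm i) (hg i)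
    refine ⟨F, G, hF, hG, LevyProkhorov.toMeasure_injective
      (ProbabilityMeasure.toMeasure_injective ?_)⟩
    rw [hν]
    have h1 : f = fun i => (F i : SymPair V → ℝ) := funext fun i => (hFf i).symm
    have h2 : g = fun i => (G i : SymPair V → ℝ) := funext fun i => (hGg i).symm
    rw [h1, h2, ← twoActionOp_vec]
    rfl

theorem coe_lawOne_twoActionOp :
    ((twoActionOp T).lawOne : Measure (EuclideanSpace ℝ (Fin 1 × Fin 3))) =
      (unif V).map (tensorVec T (fun _ _ => 1) (fun _ _ => 1)) := by
  have h1 : (Lp.const ∞ (unif V) (1 : ℝ) : SymPair V → ℝ) = fun _ => 1 :=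
    funext fun x => forall_of_ae (Lp.coeFn_const (p := ∞) (μ := unif V) (1 : ℝ)) x
  have h2 := twoActionOp_vec (T := T) (k := 1) (fun _ => Lp.const ∞ (unif V) (1 : ℝ))
    (fun _ => Lp.const ∞ (unif V) (1 : ℝ))
  rw [h1] at h2
  rw [← h2]
  rfl

/-- The first two coordinates agree with those of the constant vector, so the `L¹` distance is
exactly `meanDev T c`. -/
theorem edist_lawOne_le {c ε : ℝ} (hε : 0 < ε) (h : meanDev T c ≤ ε ^ 2) :
    edist (LevyProkhorov.ofMeasure (twoActionOp T).lawOne)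
      (LevyProkhorov.ofMeasure (diracProba (point 1 1 c))) ≤ ENNReal.ofReal ε := by
  rw [LevyProkhorov.edist_probabilityMeasure_def]
  have hdirac : (diracProba (point 1 1 c) : Measure (EuclideanSpace ℝ (Fin 1 × Fin 3))) =
      (unif V).map (fun _ => point 1 1 c) := by
    rw [Measure.map_const, measure_univ, one_smul]
    rfl
  have hm := measurable_tensorVec (T := T) (k := 1) (f := fun _ _ => 1) (g := fun _ _ => 1)
    (fun _ => measurable_const) (fun _ => measurable_const)
  change levyProkhorovEDist ((twoActionOp T).lawOne : Measure (EuclideanSpace ℝ (Fin 1 × Fin 3)))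
    (diracProba (point 1 1 c) : Measure (EuclideanSpace ℝ (Fin 1 × Fin 3))) ≤ _
  rw [hdirac, coe_lawOne_twoActionOp]
  refine levyProkhorovEDist_map_le_of_integral hm measurable_const ?_ hε ?_
  · rintro ⟨i, b⟩
    refine integrable_unif ?_
    have := (measurable_pi_apply (i, b)).comp ((WithLp.measurable_ofLp 2 _).comp hm)
    exact this.sub_const _
  · rw [sum_fin_prod_three]
    simpa [point, meanDev, tensorVec] using h

theorem tendsto_lawOne {W : ℕ → Type} [∀ n, Fintype (W n)] [∀ n, Nonempty (W n)]
    {T : ∀ n, W n → W n → W n → ℝ} {c : ℝ}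
    (h : Tendsto (fun n => meanDev (T n) c) atTop (𝓝 0)) :
    Tendsto (fun n => (twoActionOp (T n)).lawOne) atTop (𝓝 (diracProba (point 1 1 c))) := by
  have hLP : Tendsto (fun n => LevyProkhorov.ofMeasure (twoActionOp (T n)).lawOne) atTop
      (𝓝 (LevyProkhorov.ofMeasure (diracProba (point 1 1 c)))) := by
    rw [Metric.tendsto_nhds]
    intro ε hε
    filter_upwards [h.eventually_le_const (by positivity : 0 < (ε / 2) ^ 2)] with n hn
    have := edist_lawOne_le (by positivity : 0 < ε / 2) hn
    rw [edist_dist, ENNReal.ofReal_le_ofReal_iff (by positivity)] at this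
    linarith
  exact (LevyProkhorov.continuous_toMeasure_probabilityMeasure.tendsto _).comp hLP

/-- If the 1-profile of a 2-action contains a law close to `δ_{(1,1,c)}` then `T₂[1,1]` is close
to `c`. -/
theorem meanDev_le_of_edist_lt (hT : ∀ i j k, |T i j k| ≤ 1 / (Fintype.card V : ℝ)) {c ε : ℝ}
    (hc : |c| ≤ 1) (hε0 : 0 < ε) (hε : ε ≤ 1)
    {ν : LevyProkhorov (ProbabilityMeasure (EuclideanSpace ℝ (Fin 1 × Fin 3)))}
    (hν : ν ∈ (twoActionOp T).profile 1)
    (h : edist ν (LevyProkhorov.ofMeasure (diracProba (point 1 1 c))) < ENNReal.ofReal ε) :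
    meanDev T c ≤ 2 * √(5 * ε) + 3 * ε := by
  obtain ⟨f, g, hfm, hgm, hf, hg, hν⟩ := mem_profile_twoActionOp.1 hν
  have hvm := measurable_tensorVec (T := T) hfm hgm
  rw [LevyProkhorov.edist_probabilityMeasure_def] at h
  -- Testing the Lévy–Prokhorov inequality on the atom shows that the vector lies in the `ε`-ball
  -- around `(1,1,c)` with probability at least `1 - ε`.
  have h1 := right_measure_le_of_levyProkhorovEDist_lt h (measurableSet_singleton (point 1 1 c))
  rw [ENNReal.toReal_ofReal hε0.le, Metric.thickening_singleton] at h1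
  have h2 : (1 : ℝ≥0∞) ≤ (unif V) (tensorVec T f g ⁻¹' Metric.ball (point 1 1 c) ε) +
      ENNReal.ofReal ε := by
    rw [← Measure.map_apply hvm Metric.isOpen_ball.measurableSet]
    rw [hν] at h1
    refine le_trans (le_of_eq ?_) h1
    exact (diracProba_toMeasure_apply_of_mem (Set.mem_singleton _)).symm
  set G : Set (SymPair V) := tensorVec T f g ⁻¹' Metric.ball (point 1 1 c) ε with hGdef
  have hG : MeasurableSet G :=
    hvm Metric.isOpen_ball.measurableSet
  have hGε : (unif V).real Gᶜ ≤ ε := by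
    rw [probReal_compl_eq_one_sub hG]
    have := ENNReal.toReal_mono (by finiteness) h2
    rw [ENNReal.toReal_add (measure_ne_top _ _) ENNReal.ofReal_ne_top,
      ENNReal.toReal_ofReal hε0.le, ENNReal.toReal_one] at this
    simp only [measureReal_def]
    linarith
  have hcoord : ∀ x ∈ G, ∀ b : Fin 3,
      |tensorVec T f g x (0, b) - point 1 1 c (0, b)| ≤ ε := by
    intro x hx b
    have hx : dist (tensorVec T f g x) (point 1 1 c) < ε := hx
    rw [dist_eq_norm] at hx
    have := PiLp.norm_apply_le (tensorVec T f g x - point 1 1 c) (0, b)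
    rw [Real.norm_eq_abs] at this
    exact this.trans hx.le
  exact meanDev_le_of_close hT (hfm 0) (hgm 0) (hf 0) (hg 0) hc hε0.le hε hG hGε
    (fun x hx => hcoord x hx 0) (fun x hx => hcoord x hx 1) fun x hx => hcoord x hx 2

theorem MultiPOp.hausdorffEDist_eq_zero_of_dM {K : MultiPOp.{u}} {L : MultiPOp.{v}}
    (h : MultiPOp.dM K L = 0) (k : ℕ) :
    Metric.hausdorffEDist (K.profile (k + 1)) (L.profile (k + 1)) = 0 := by
  have := ENNReal.tsum_eq_zero.1 h k
  rcases mul_eq_zero.1 this with h0 | h0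
  · exact absurd h0 (pow_ne_zero _ (by simp))
  · exact h0

theorem MultiPOp.dM_comm (K : MultiPOp.{u}) (L : MultiPOp.{v}) :
    MultiPOp.dM K L = MultiPOp.dM L K := by
  unfold MultiPOp.dM
  simp only [Metric.hausdorffEDist_comm]

theorem HaveDifferentLimits.symm {A B : ℕ → MultiPOp.{0}} (h : HaveDifferentLimits.{v, u} A B) :
    HaveDifferentLimits.{u, v} B A := fun K L hK hL => by
  rw [MultiPOp.dM_comm]
  exact h L K hL hK

/-- If the limits were at distance zero, the laws of `(1,1,A[1,1])` would have neighbours in the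
1-profiles of the second sequence. These neighbours would be close to `δ_(1,1,c)` and force
`meanDev` below `η`. -/
theorem haveDifferentLimits_of_meanDev {A : ℕ → MultiPOp.{0}} {W : ℕ → Type} [∀ n, Fintype (W n)]
    [∀ n, Nonempty (W n)] {T : ∀ n, W n → W n → W n → ℝ}
    (hT : ∀ n i j k, |T n i j k| ≤ 1 / (Fintype.card (W n) : ℝ)) {c : ℝ} (hc : |c| ≤ 1)
    (hA : Tendsto (fun n => (A n).lawOne) atTop (𝓝 (diracProba (point 1 1 c)))) {η : ℝ} (hη : 0 < η)
    (hB : ∀ᶠ n in atTop, η ≤ meanDev (T n) c) :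
    HaveDifferentLimits.{u, v} A (fun n => twoActionOp (T n)) := by
  rintro K L ⟨φ, hφ, hK⟩ ⟨ψ, hψ, hL⟩
  by_contra h0
  have h0 := MultiPOp.hausdorffEDist_eq_zero_of_dM (nonpos_iff_eq_zero.1 (not_lt.1 h0)) 0
  rw [zero_add] at h0
  obtain ⟨ε, hε0, hε1, hεη⟩ : ∃ ε : ℝ, 0 < ε ∧ ε ≤ 1 ∧ 2 * √(5 * ε) + 3 * ε < η := by
    have hcont : Tendsto (fun ε : ℝ => 2 * √(5 * ε) + 3 * ε) (𝓝[>] 0) (𝓝 0) := by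
      have : ContinuousAt (fun ε : ℝ => 2 * √(5 * ε) + 3 * ε) 0 := by fun_prop
      have h := this.tendsto
      simp only [mul_zero, Real.sqrt_zero, add_zero] at h
      exact h.mono_left nhdsWithin_le_nhds
    have := (hcont.eventually_lt_const hη).and (Ioc_mem_nhdsGT (zero_lt_one' ℝ))
    obtain ⟨ε, h1, h2⟩ := this.exists
    exact ⟨ε, h2.1, h2.2, h1⟩
  -- Three errors are added: from each sequence to its limit, and from `lawOne` to the Dirac
  -- measure.
  have hε4 : (0 : ℝ≥0∞) < ENNReal.ofReal (ε / 4) := ENNReal.ofReal_pos.2 (by positivity)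
  have e1 := (hK.2 1 le_rfl).eventually_lt_const hε4
  have e2 := (hL.2 1 le_rfl).eventually_lt_const hε4
  have e3 : ∀ᶠ n in atTop, edist (LevyProkhorov.ofMeasure (A (φ n)).lawOne)
      (LevyProkhorov.ofMeasure (diracProba (point 1 1 c))) < ENNReal.ofReal (ε / 4) := by
    have := ((LevyProkhorov.continuous_ofMeasure_probabilityMeasure.tendsto _).comp hA).comp
      hφ.tendsto_atTop
    exact (EMetric.tendsto_nhds.1 this) _ hε4
  have e4 := hψ.tendsto_atTop.eventually hB
  obtain ⟨n, h1, h2, h3, h4⟩ := (e1.and (e2.and (e3.and e4))).exists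
  have hH : Metric.hausdorffEDist ((A (φ n)).profile 1) ((twoActionOp (T (ψ n))).profile 1) <
      ENNReal.ofReal (ε / 4) + ENNReal.ofReal (ε / 4) := by
    calc _ ≤ Metric.hausdorffEDist ((A (φ n)).profile 1) (K.profile 1) +
          (Metric.hausdorffEDist (K.profile 1) (L.profile 1) +
            Metric.hausdorffEDist (L.profile 1) ((twoActionOp (T (ψ n))).profile 1)) :=
          Metric.hausdorffEDist_triangle.trans (add_le_add_right Metric.hausdorffEDist_triangle _)
      _ < _ := by
          rw [h0, zero_add, Metric.hausdorffEDist_comm (s := L.profile 1)]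
          exact ENNReal.add_lt_add h1 h2
  obtain ⟨ν, hν, hνd⟩ := Metric.exists_edist_lt_of_hausdorffEDist_lt
    ((A (φ n)).law_mem_profile (k := 1) (fun _ => (A (φ n)).one_mem_unitFun)
      (fun _ => (A (φ n)).one_mem_unitFun)) hH
  refine absurd (meanDev_le_of_edist_lt (hT (ψ n)) hc hε0 hε1 hν ?_) (not_le.2 (hεη.trans_le h4))
  calc edist ν (LevyProkhorov.ofMeasure (diracProba (point 1 1 c)))
      ≤ edist ν (LevyProkhorov.ofMeasure (A (φ n)).lawOne) +
        edist (LevyProkhorov.ofMeasure (A (φ n)).lawOne)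
          (LevyProkhorov.ofMeasure (diracProba (point 1 1 c))) := edist_triangle _ _ _
    _ < ENNReal.ofReal (ε / 4) + ENNReal.ofReal (ε / 4) + ENNReal.ofReal (ε / 4) := by
        rw [edist_comm ν]
        exact ENNReal.add_lt_add hνd h3
    _ = ENNReal.ofReal (ε / 4 + ε / 4 + ε / 4) := by
        rw [ENNReal.ofReal_add, ENNReal.ofReal_add] <;> positivity
    _ ≤ ENNReal.ofReal ε := ENNReal.ofReal_le_ofReal (by linarith)

end DifferentLimits

/-! ### The limit space of a sequence of 2-actions -/

section ContinuousLp

variable {α : Type*} [TopologicalSpace α] [CompactSpace α] [MeasurableSpace α] [BorelSpace α]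
  {μ : Measure α} [IsFiniteMeasure μ]

theorem norm_toLp_two (F : C(α, ℝ)) :
    ‖ContinuousMap.toLp 2 μ ℝ F‖ = √(∫ p, F p ^ 2 ∂μ) := by
  have h : ‖ContinuousMap.toLp 2 μ ℝ F‖ ^ 2 = ∫ p, F p ^ 2 ∂μ := by
    rw [← real_inner_self_eq_norm_sq, L2.inner_def]
    refine integral_congr_ae ?_
    filter_upwards [ContinuousMap.coeFn_toLp (p := 2) (𝕜 := ℝ) μ F] with p hp
    rw [hp, real_inner_self_eq_norm_sq, Real.norm_eq_abs, sq_abs]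
  rw [← h, Real.sqrt_sq (norm_nonneg _)]

theorem norm_toLp_one (F : C(α, ℝ)) :
    ‖ContinuousMap.toLp 1 μ ℝ F‖ = ∫ p, |F p| ∂μ := by
  rw [L1.norm_eq_integral_norm]
  refine integral_congr_ae ?_
  filter_upwards [ContinuousMap.coeFn_toLp (p := 1) (𝕜 := ℝ) μ F] with p hp
  rw [hp, Real.norm_eq_abs]

end ContinuousLp

section LimitSpace

instance (X : Type*) : MeasurableSpace (Ultrafilter X) := borel _

instance (X : Type*) : BorelSpace (Ultrafilter X) := ⟨rfl⟩

/-- The extension of a bounded function to the Stone–Čech compactification of a discrete space. -/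
noncomputable def extendBdd {X : Type*} {C : ℝ} (h : X → ℝ) (hC : ∀ x, |h x| ≤ C) :
    C(Ultrafilter X, ℝ) where
  toFun p := Subtype.val
    (Ultrafilter.extend (γ := Set.Icc (-C) C) (fun x => ⟨h x, abs_le.1 (hC x)⟩) p)
  continuous_toFun := continuous_subtype_val.comp (continuous_ultrafilter_extend _)

theorem extendBdd_pure {X : Type*} {C : ℝ} (h : X → ℝ) (hC : ∀ x, |h x| ≤ C) (x : X) :
    extendBdd h hC (pure x) = h x :=
  congrArg Subtype.val
    (ultrafilter_extend_pure (fun x => (⟨h x, abs_le.1 (hC x)⟩ : Set.Icc (-C) C)) x)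

theorem abs_extendBdd_le {X : Type*} {C : ℝ} (h : X → ℝ) (hC : ∀ x, |h x| ≤ C)
    (p : Ultrafilter X) : |extendBdd h hC p| ≤ C :=
  abs_le.2 (Ultrafilter.extend (γ := Set.Icc (-C) C) (fun x => ⟨h x, abs_le.1 (hC x)⟩) p).2

variable {V : ℕ → Type}

/-- The point of the limit space given by a pair of vertices of the `n`-th structure. -/
def limitPoint (n : ℕ) (x : SymPair (V n)) : Ultrafilter (Σ n, Sym2 (V n)) :=
  pure ⟨n, s(x.fst, x.snd)⟩

theorem limitPoint_symm (n : ℕ) (i k : V n) :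
    limitPoint n (SymPair.mk i k) = limitPoint n (.mk k i) := by
  change pure (⟨n, s(i, k)⟩ : Σ n, Sym2 (V n)) = pure ⟨n, s(k, i)⟩
  rw [Sym2.eq_swap]

theorem measurable_limitPoint (n : ℕ) : Measurable (limitPoint (V := V) n) := by
  intro s _
  refine measurableSet_symPair.2 fun i k => ?_
  change limitPoint n (SymPair.mk i k) ∈ s ↔ limitPoint n (SymPair.mk k i) ∈ s
  rw [limitPoint_symm]

/-- Principal ultrafilters are dense, so identities valid at every finite level, such as bilinearity
of the action, hold on the whole limit space. -/
theorem continuousMap_ext_limitPoint {F G : C(Ultrafilter (Σ n, Sym2 (V n)), ℝ)}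
    (h : ∀ n x, F (limitPoint n x) = G (limitPoint n x)) : F = G := by
  refine ContinuousMap.ext fun p => congrFun (F.continuous.ext_on denseRange_pure G.continuous ?_) p
  rintro _ ⟨⟨n, y⟩, rfl⟩
  induction y using Sym2.ind with
  | _ i k => exact h n (.mk i k)

/-- Uniformly bounded symmetric functions on the structures come from a continuous function on the
limit space. -/
theorem exists_continuousMap_limitPoint {f : ∀ n, SymPair (V n) → ℝ} (hf : ∀ n, Measurable (f n))
    {C : ℝ} (hC : ∀ n x, |f n x| ≤ C) :
    ∃ F : C(Ultrafilter (Σ n, Sym2 (V n)), ℝ),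
      (∀ n x, F (limitPoint n x) = f n x) ∧ ∀ p, |F p| ≤ C := by
  let h : (Σ n, Sym2 (V n)) → ℝ := fun y =>
    Sym2.lift ⟨fun i k => f y.1 (.mk i k), fun i k => symm_of_measurable (hf y.1) i k⟩ y.2
  have hh : ∀ y, |h y| ≤ C := by
    rintro ⟨n, y⟩
    induction y using Sym2.ind with
    | _ i k => exact hC n (.mk i k)
  exact ⟨extendBdd h hh, fun n x => extendBdd_pure h hh _, abs_extendBdd_le h hh⟩

variable [∀ n, Fintype (V n)] [∀ n, Nonempty (V n)]

/-- A limit of the uniform measures along an ultrafilter. -/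
theorem exists_limitMeasure (V : ℕ → Type) [∀ n, Fintype (V n)] [∀ n, Nonempty (V n)]
    (U : Ultrafilter ℕ) :
    ∃ μ : Measure (Ultrafilter (Σ n, Sym2 (V n))), IsProbabilityMeasure μ ∧ μ.Regular ∧
      ∀ F : C(Ultrafilter (Σ n, Sym2 (V n)), ℝ),
        Tendsto (fun n => ∫ x, F (limitPoint n x) ∂(unif (V n))) U (𝓝 (∫ p, F p ∂μ)) := by
  let μn : ℕ → ProbabilityMeasure (Ultrafilter (Σ n, Sym2 (V n))) := fun n =>
    ⟨(unif (V n)).map (limitPoint n),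
      Measure.isProbabilityMeasure_map (measurable_limitPoint n).aemeasurable⟩
  obtain ⟨μ', -, hμ'⟩ := isCompact_univ.ultrafilter_le_nhds (U.map μn) (by simp)
  have hlim : Tendsto μn U (𝓝 μ') := hμ'
  -- The space is not metrizable in general, so the limit measure is exchanged for a regular one
  -- with the same integrals of continuous functions; regularity gives density of continuous
  -- functions in `L²`.
  obtain ⟨μ, hreg, hfin, hμ⟩ := Measure.exists_regular_eq_of_compactSpace
    (μ' : Measure (Ultrafilter (Σ n, Sym2 (V n))))
  refine ⟨μ, ⟨?_⟩, hreg, fun F => ?_⟩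
  · have := hμ 1
    simp only [BoundedContinuousFunction.coe_one, Pi.one_apply, integral_const, probReal_univ,
      smul_eq_mul, mul_one] at this
    rw [← ENNReal.ofReal_toReal (measure_ne_top μ Set.univ), ← measureReal_def, ← this]
    simp
  · have h1 := ProbabilityMeasure.tendsto_iff_forall_integral_tendsto.1 hlim
      (BoundedContinuousFunction.mkOfCompact F)
    rw [hμ] at h1
    refine h1.congr fun n => ?_
    exact integral_map (measurable_limitPoint n).aemeasurable
      F.continuous.aestronglyMeasurable

/-- The operator on continuous functions on the limit space. -/
theorem exists_limitAction {T : ∀ n, V n → V n → V n → ℝ}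
    (hT : ∀ n i j k, |T n i j k| ≤ 1 / (Fintype.card (V n) : ℝ))
    (F G : C(Ultrafilter (Σ n, Sym2 (V n)), ℝ)) :
    ∃ H : C(Ultrafilter (Σ n, Sym2 (V n)), ℝ), (∀ n x, H (limitPoint n x) =
      twoAction (T n) (fun y => F (limitPoint n y)) (fun y => G (limitPoint n y)) x) ∧
      ∀ p, |H p| ≤ ‖F‖ * ‖G‖ :=
  exists_continuousMap_limitPoint (fun _ => measurable_twoAction _ _ _) fun n =>
    abs_twoAction_le (hT n) (fun _ => F.norm_coe_le_norm _) (fun _ => G.norm_coe_le_norm _)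

/-- The operator on continuous functions on the limit space. -/
noncomputable def limitAction {T : ∀ n, V n → V n → V n → ℝ}
    (hT : ∀ n i j k, |T n i j k| ≤ 1 / (Fintype.card (V n) : ℝ))
    (F G : C(Ultrafilter (Σ n, Sym2 (V n)), ℝ)) : C(Ultrafilter (Σ n, Sym2 (V n)), ℝ) :=
  (exists_limitAction hT F G).choose

variable {T : ∀ n, V n → V n → V n → ℝ}
  (hT : ∀ n i j k, |T n i j k| ≤ 1 / (Fintype.card (V n) : ℝ))

theorem limitAction_limitPoint (F G : C(Ultrafilter (Σ n, Sym2 (V n)), ℝ)) (n : ℕ)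
    (x : SymPair (V n)) : limitAction hT F G (limitPoint n x) =
      twoAction (T n) (fun y => F (limitPoint n y)) (fun y => G (limitPoint n y)) x :=
  (exists_limitAction hT F G).choose_spec.1 n x

theorem abs_limitAction_le (F G : C(Ultrafilter (Σ n, Sym2 (V n)), ℝ))
    (p : Ultrafilter (Σ n, Sym2 (V n))) : |limitAction hT F G p| ≤ ‖F‖ * ‖G‖ :=
  (exists_limitAction hT F G).choose_spec.2 p

variable {U : Ultrafilter ℕ} {μ : Measure (Ultrafilter (Σ n, Sym2 (V n)))}
  [IsProbabilityMeasure μ]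

/-- Both sides are limits along `U` of the corresponding finite quantities, for which this is the
Cauchy–Schwarz estimate. -/
theorem norm_toLp_limitAction_le
    (hμ : ∀ F : C(Ultrafilter (Σ n, Sym2 (V n)), ℝ),
      Tendsto (fun n => ∫ x, F (limitPoint n x) ∂(unif (V n))) U (𝓝 (∫ p, F p ∂μ)))
    (F G : C(Ultrafilter (Σ n, Sym2 (V n)), ℝ)) :
    ‖ContinuousMap.toLp 1 μ ℝ (limitAction hT F G)‖ ≤
      ‖ContinuousMap.toLp 2 μ ℝ F‖ * ‖ContinuousMap.toLp 2 μ ℝ G‖ := by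
  rw [norm_toLp_one, norm_toLp_two, norm_toLp_two]
  have h1 := hμ |limitAction hT F G|
  have h2 := (hμ (F ^ 2)).sqrt.mul (hμ (G ^ 2)).sqrt
  refine le_of_tendsto_of_tendsto' h1 h2 fun n => ?_
  simp only [ContinuousMap.coe_abs, Pi.abs_apply, limitAction_limitPoint, ContinuousMap.coe_pow, Pi.pow_apply]
  exact integral_abs_twoAction_le (hT n)
    (F.continuous.measurable.comp (measurable_limitPoint n))
    (G.continuous.measurable.comp (measurable_limitPoint n))

/-- The operator on continuous functions as a bilinear map into `L¹`. -/
noncomputable def limitBilin (μ : Measure (Ultrafilter (Σ n, Sym2 (V n)))) [IsProbabilityMeasure μ] :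
    C(Ultrafilter (Σ n, Sym2 (V n)), ℝ) →ₗ[ℝ] C(Ultrafilter (Σ n, Sym2 (V n)), ℝ) →ₗ[ℝ] Lp ℝ 1 μ :=
  LinearMap.mk₂ ℝ (fun F G => ContinuousMap.toLp 1 μ ℝ (limitAction hT F G))
    (fun F F' G => by
      rw [← map_add]
      congr 1
      refine continuousMap_ext_limitPoint fun n x => ?_
      rw [ContinuousMap.add_apply]
      simp only [limitAction_limitPoint]
      exact congrFun (twoAction_add_left (T n) _ _ _) x)
    (fun c F G => by
      rw [← map_smul]
      congr 1
      refine continuousMap_ext_limitPoint fun n x => ?_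
      rw [ContinuousMap.smul_apply]
      simp only [limitAction_limitPoint]
      exact congrFun (twoAction_smul_left (T n) c _ _) x)
    (fun F G G' => by
      rw [← map_add]
      congr 1
      refine continuousMap_ext_limitPoint fun n x => ?_
      rw [ContinuousMap.add_apply]
      simp only [limitAction_limitPoint]
      exact congrFun (twoAction_add_right (T n) _ _ _) x)
    (fun c F G => by
      rw [← map_smul]
      congr 1
      refine continuousMap_ext_limitPoint fun n x => ?_
      rw [ContinuousMap.smul_apply]
      simp only [limitAction_limitPoint]
      exact congrFun (twoAction_smul_right (T n) c _ _) x)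

end LimitSpace

/-! ### Extension of bilinear maps and the inclusion of `L^∞` into `L²` -/

section BilinearExtension

/-- Extension of a bilinear map along a dense map. -/
theorem exists_bilinear_extension {E H F : Type*} [AddCommGroup E] [Module ℝ E]
    [NormedAddCommGroup H] [NormedSpace ℝ H] [NormedAddCommGroup F] [NormedSpace ℝ F]
    [CompleteSpace F] (e : E →ₗ[ℝ] H) (he : DenseRange e) (b : E →ₗ[ℝ] E →ₗ[ℝ] F)
    (hb : ∀ x y, ‖b x y‖ ≤ ‖e x‖ * ‖e y‖) :
    ∃ B : H →L[ℝ] H →L[ℝ] F, (∀ x y, B (e x) (e y) = b x y) ∧ ∀ x y, ‖B x y‖ ≤ ‖x‖ * ‖y‖ := by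
  -- The second argument is extended first, for each fixed `x`; the resulting operator-valued map is
  -- then extended in `x`. Uniqueness of extensions gives linearity in `x`.
  let b₁ : E →ₗ[ℝ] H →L[ℝ] F :=
    { toFun := fun x => (b x).extendOfNorm e
      map_add' := fun x x' => by
        refine LinearMap.extendOfNorm_unique he ‖e (x + x')‖ (hb (x + x')) _ ?_
        ext y
        simp [LinearMap.extendOfNorm_eq he ⟨_, hb x⟩, LinearMap.extendOfNorm_eq he ⟨_, hb x'⟩]
      map_smul' := fun c x => by
        refine LinearMap.extendOfNorm_unique he ‖e (c • x)‖ (hb (c • x)) _ ?_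
        ext y
        simp [LinearMap.extendOfNorm_eq he ⟨_, hb x⟩] }
  have hb₁ : ∀ x, ‖b₁ x‖ ≤ 1 * ‖e x‖ := fun x => by
    rw [one_mul]
    exact LinearMap.opNorm_extendOfNorm_le he (norm_nonneg _) (hb x)
  refine ⟨b₁.extendOfNorm e, fun x y => ?_, fun x y => ?_⟩
  · rw [LinearMap.extendOfNorm_eq he ⟨1, hb₁⟩]
    exact LinearMap.extendOfNorm_eq he ⟨_, hb x⟩ y
  · refine ((b₁.extendOfNorm e x).le_opNorm y).trans ?_
    gcongr
    simpa using LinearMap.norm_extendOfNorm_apply_le he 1 hb₁ x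

variable {Ω : Type*} [MeasurableSpace Ω] (μ : Measure Ω) [IsProbabilityMeasure μ]

theorem memLp_two_of_memLp_top (f : Lp ℝ ∞ μ) : MemLp f 2 μ :=
  (Lp.memLp f).mono_exponent le_top

/-- The inclusion of `L^∞` into `L²`. -/
noncomputable def topToTwo : Lp ℝ ∞ μ →L[ℝ] Lp ℝ 2 μ :=
  LinearMap.mkContinuous
    { toFun := fun f => (memLp_two_of_memLp_top μ f).toLp
      map_add' := fun f g => by
        rw [← MemLp.toLp_add]
        exact MemLp.toLp_congr _ _ (Lp.coeFn_add f g)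
      map_smul' := fun c f => by
        rw [RingHom.id_apply, ← MemLp.toLp_const_smul]
        exact MemLp.toLp_congr _ _ (Lp.coeFn_smul c f) } 1 fun f => by
    rw [one_mul]
    change ‖(memLp_two_of_memLp_top μ f).toLp‖ ≤ _
    rw [Lp.norm_toLp, Lp.norm_def]
    refine ENNReal.toReal_mono (Lp.eLpNorm_ne_top f) ?_
    exact eLpNorm_le_eLpNorm_of_exponent_le le_top (Lp.aestronglyMeasurable f)

theorem coeFn_topToTwo (f : Lp ℝ ∞ μ) : topToTwo μ f =ᵐ[μ] f :=
  (memLp_two_of_memLp_top μ f).coeFn_toLp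

end BilinearExtension

/-! ### Approximation of profiles by laws of continuous functions -/

section LimitOperator

variable {Ω : Type*} [MeasurableSpace Ω] {μ : Measure Ω} [IsProbabilityMeasure μ]

theorem integral_abs_le_norm_two (a : Lp ℝ 2 μ) : ∫ x, |a x| ∂μ ≤ ‖a‖ := by
  have h1 : MemLp a 1 μ := (Lp.memLp a).mono_exponent (by norm_num)
  have h2 : ∫ x, |a x| ∂μ = (eLpNorm a 1 μ).toReal := by
    rw [eLpNorm_one_eq_lintegral_enorm, ← integral_norm_eq_lintegral_enorm h1.aestronglyMeasurable]
    rfl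
  rw [h2, Lp.norm_def]
  exact ENNReal.toReal_mono (Lp.eLpNorm_ne_top a)
    (eLpNorm_le_eLpNorm_of_exponent_le (by norm_num) (Lp.aestronglyMeasurable a))

theorem norm_topToTwo_le_one {f : Lp ℝ ∞ μ} (hf : ∀ᵐ x ∂μ, f x ∈ Set.Icc (-1 : ℝ) 1) :
    ‖topToTwo μ f‖ ≤ 1 := by
  have h : ∀ᵐ x ∂μ, ‖topToTwo μ f x‖ ≤ 1 := by
    filter_upwards [hf, coeFn_topToTwo μ f] with x hx hx'
    rw [hx', Real.norm_eq_abs]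
    exact abs_le.2 hx
  have h1 : measureUnivNNReal μ = 1 := by simp [measureUnivNNReal]
  simpa [h1] using Lp.norm_le_of_ae_bound zero_le_one h

variable {α : Type} [TopologicalSpace α]

/-- The random vector of continuous functions and of a continuous image. -/
noncomputable def contVec (act : C(α, ℝ) → C(α, ℝ) → C(α, ℝ)) {k : ℕ} (F G : Fin k → C(α, ℝ))
    (x : α) : EuclideanSpace ℝ (Fin k × Fin 3) :=
  WithLp.toLp 2 fun p => ![F p.1 x, G p.1 x, act (F p.1) (G p.1) x] p.2

theorem continuous_contVec (act : C(α, ℝ) → C(α, ℝ) → C(α, ℝ)) {k : ℕ} (F G : Fin k → C(α, ℝ)) :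
    Continuous (contVec act F G) := by
  refine (PiLp.continuous_toLp 2 _).comp (continuous_pi ?_)
  rintro ⟨i, c⟩
  fin_cases c
  · exact (F i).continuous
  · exact (G i).continuous
  · exact (act (F i) (G i)).continuous

variable [CompactSpace α] [MeasurableSpace α]
  [BorelSpace α] {μ : Measure α} [IsProbabilityMeasure μ]

theorem topToTwo_toLp (F : C(α, ℝ)) :
    topToTwo μ (ContinuousMap.toLp ∞ μ ℝ F) = ContinuousMap.toLp 2 μ ℝ F := by
  refine Lp.ext ?_
  filter_upwards [coeFn_topToTwo μ (ContinuousMap.toLp ∞ μ ℝ F),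
    ContinuousMap.coeFn_toLp (p := ∞) (𝕜 := ℝ) μ F,
    ContinuousMap.coeFn_toLp (p := 2) (𝕜 := ℝ) μ F] with x h1 h2 h3
  rw [h1, h2, h3]

/-- Approximation of functions with values in `[-1,1]` by continuous ones. -/
theorem exists_continuousMap_close [T2Space α] [μ.Regular] {f : Lp ℝ ∞ μ}
    (hf : ∀ᵐ x ∂μ, f x ∈ Set.Icc (-1 : ℝ) 1) {δ : ℝ} (hδ : 0 < δ) :
    ∃ F : C(α, ℝ), (∀ x, |F x| ≤ 1) ∧ ‖topToTwo μ f - ContinuousMap.toLp 2 μ ℝ F‖ ≤ δ := by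
  obtain ⟨F₀, hF₀⟩ := (ContinuousMap.toLp_denseRange ℝ μ ℝ (p := 2) (by norm_num)).exists_dist_lt
    (topToTwo μ f) hδ
  -- Truncation to `[-1,1]` does not increase the distance to `f`, whose values lie there almost
  -- everywhere.
  let F : C(α, ℝ) := ⟨fun x => max (-1) (min (F₀ x) 1), by fun_prop⟩
  refine ⟨F, fun x => abs_le.2 ⟨le_max_left _ _, max_le (by norm_num) (min_le_right _ _)⟩, ?_⟩
  rw [dist_eq_norm] at hF₀
  refine le_trans (Lp.norm_le_norm_of_ae_le ?_) hF₀.le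
  filter_upwards [hf, coeFn_topToTwo μ f, ContinuousMap.coeFn_toLp (p := 2) (𝕜 := ℝ) μ F,
    ContinuousMap.coeFn_toLp (p := 2) (𝕜 := ℝ) μ F₀,
    Lp.coeFn_sub (topToTwo μ f) (ContinuousMap.toLp 2 μ ℝ F),
    Lp.coeFn_sub (topToTwo μ f) (ContinuousMap.toLp 2 μ ℝ F₀)] with x hx h1 h2 h3 h4 h5
  rw [h4, h5, Pi.sub_apply, Pi.sub_apply, h1, h2, h3, Real.norm_eq_abs, Real.norm_eq_abs]
  change |f x - max (-1) (min (F₀ x) 1)| ≤ |f x - F₀ x|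
  obtain ⟨hx1, hx2⟩ := hx
  rcases le_total (F₀ x) 1 with h | h
  · rw [min_eq_left h]
    rcases le_total (-1) (F₀ x) with h' | h'
    · rw [max_eq_right h']
    · rw [max_eq_left h', abs_of_nonneg (by linarith), abs_of_nonneg (by linarith)]
      linarith
  · rw [min_eq_right h, max_eq_right (by norm_num), abs_of_nonpos (by linarith),
      abs_of_nonpos (by linarith)]
    linarith

/-- The law of `contVec`. -/
noncomputable def contLaw (μ : Measure α) [IsProbabilityMeasure μ]
    (act : C(α, ℝ) → C(α, ℝ) → C(α, ℝ)) {k : ℕ} (F G : Fin k → C(α, ℝ)) :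
    ProbabilityMeasure (EuclideanSpace ℝ (Fin k × Fin 3)) :=
  ⟨μ.map (contVec act F G),
    Measure.isProbabilityMeasure_map (continuous_contVec act F G).measurable.aemeasurable⟩

/-- The laws of continuous functions with values in `[-1,1]` and of their images. -/
def contProfile (μ : Measure α) [IsProbabilityMeasure μ]
    (act : C(α, ℝ) → C(α, ℝ) → C(α, ℝ)) (k : ℕ) :
    Set (LevyProkhorov (ProbabilityMeasure (EuclideanSpace ℝ (Fin k × Fin 3)))) :=
  {ν | ∃ F G : Fin k → C(α, ℝ), (∀ i x, |F i x| ≤ 1) ∧ (∀ i x, |G i x| ≤ 1) ∧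
    ν = LevyProkhorov.ofMeasure (contLaw μ act F G)}

/-- All these laws live in one fixed ball, so they are tight, and Prokhorov's theorem gives a
compact closure. -/
theorem totallyBounded_contProfile {act : C(α, ℝ) → C(α, ℝ) → C(α, ℝ)}
    (hact : ∀ F G x, |act F G x| ≤ ‖F‖ * ‖G‖) (k : ℕ) : TotallyBounded (contProfile μ act k) := by
  set S : Set (ProbabilityMeasure (EuclideanSpace ℝ (Fin k × Fin 3))) :=
    {ν | LevyProkhorov.ofMeasure ν ∈ contProfile μ act k}
  have htight : IsTightMeasureSet
      {((ν : ProbabilityMeasure (EuclideanSpace ℝ (Fin k × Fin 3))) :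
        Measure (EuclideanSpace ℝ (Fin k × Fin 3))) | ν ∈ S} := by
    rw [isTightMeasureSet_iff_exists_isCompact_measure_compl_le]
    intro ε _
    refine ⟨Metric.closedBall 0 (∑ _p : Fin k × Fin 3, 1), isCompact_closedBall _ _, ?_⟩
    rintro _ ⟨ν, ⟨F, G, hF, hG, hν⟩, rfl⟩
    have hν : ν = contLaw μ act F G := congrArg LevyProkhorov.toMeasure hν
    have h0 : (contLaw μ act F G : Measure (EuclideanSpace ℝ (Fin k × Fin 3)))
        (Metric.closedBall 0 (∑ _p : Fin k × Fin 3, 1))ᶜ = 0 := by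
      change (μ.map (contVec act F G)) _ = 0
      rw [Measure.map_apply (continuous_contVec act F G).measurable
        Metric.isClosed_closedBall.measurableSet.compl]
      convert measure_empty (μ := μ)
      ext x
      simp only [Set.preimage_compl, Set.mem_compl_iff, Set.mem_preimage, mem_closedBall_zero_iff,
        Set.mem_empty_iff_false, iff_false, not_not]
      refine (norm_le_sum_abs _).trans (Finset.sum_le_sum ?_)
      rintro ⟨i, c⟩ -
      fin_cases c
      · exact hF i x
      · exact hG i x
      · refine (hact (F i) (G i) x).trans ?_
        have h1 : ‖F i‖ ≤ 1 := (ContinuousMap.norm_le _ zero_le_one).2 (hF i)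
        have h2 : ‖G i‖ ≤ 1 := (ContinuousMap.norm_le _ zero_le_one).2 (hG i)
        exact mul_le_one₀ h1 (norm_nonneg _) h2
    rw [hν, h0]
    exact zero_le
  have hcomp := (isCompact_closure_of_isTightMeasureSet htight).image
    (LevyProkhorov.continuous_ofMeasure_probabilityMeasure
      (Ω := EuclideanSpace ℝ (Fin k × Fin 3)))
  refine hcomp.totallyBounded.subset ?_
  intro ν hν
  exact ⟨ν.toMeasure, subset_closure hν, rfl⟩

variable {act : C(α, ℝ) → C(α, ℝ) → C(α, ℝ)} {op : Lp ℝ ∞ μ →L[ℝ] Lp ℝ ∞ μ →L[ℝ] Lp ℝ 1 μ}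

theorem contProfile_subset_profile
    (hact : ∀ F G, op (ContinuousMap.toLp ∞ μ ℝ F) (ContinuousMap.toLp ∞ μ ℝ G) =
      ContinuousMap.toLp 1 μ ℝ (act F G)) (k : ℕ) :
    contProfile μ act k ⊆ (MultiPOp.mk (Ω := α) μ op).profile k := by
  rintro ν ⟨F, G, hF, hG, rfl⟩
  have hunit : ∀ H : C(α, ℝ), (∀ x, |H x| ≤ 1) →
      ContinuousMap.toLp ∞ μ ℝ H ∈ (MultiPOp.mk (Ω := α) μ op).unitFun := by
    intro H hH
    change ∀ᵐ x ∂μ, ContinuousMap.toLp ∞ μ ℝ H x ∈ Set.Icc (-1 : ℝ) 1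
    filter_upwards [ContinuousMap.coeFn_toLp (p := ∞) (𝕜 := ℝ) μ H] with x hx
    rw [hx]
    exact abs_le.1 (hH x)
  refine ⟨fun i => ContinuousMap.toLp ∞ μ ℝ (F i), fun i => ContinuousMap.toLp ∞ μ ℝ (G i),
    fun i => hunit _ (hF i), fun i => hunit _ (hG i), LevyProkhorov.toMeasure_injective
      (ProbabilityMeasure.toMeasure_injective ?_)⟩
  change μ.map (contVec act F G) = μ.map ((MultiPOp.mk (Ω := α) μ op).vec
    (fun i => ContinuousMap.toLp ∞ μ ℝ (F i)) fun i => ContinuousMap.toLp ∞ μ ℝ (G i))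
  refine Measure.map_congr ?_
  have h1 : ∀ᵐ x ∂μ, ∀ i, ContinuousMap.toLp ∞ μ ℝ (F i) x = F i x :=
    ae_all_iff.2 fun i => ContinuousMap.coeFn_toLp (p := ∞) (𝕜 := ℝ) μ (F i)
  have h2 : ∀ᵐ x ∂μ, ∀ i, ContinuousMap.toLp ∞ μ ℝ (G i) x = G i x :=
    ae_all_iff.2 fun i => ContinuousMap.coeFn_toLp (p := ∞) (𝕜 := ℝ) μ (G i)
  have h3 : ∀ᵐ x ∂μ, ∀ i, ContinuousMap.toLp 1 μ ℝ (act (F i) (G i)) x = act (F i) (G i) x :=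
    ae_all_iff.2 fun i => ContinuousMap.coeFn_toLp (p := 1) (𝕜 := ℝ) μ (act (F i) (G i))
  filter_upwards [h1, h2, h3] with x h1 h2 h3
  unfold contVec MultiPOp.vec
  simp only [hact, h1, h2, h3]

/-- Since `op` is bounded for the `L²` norms of its arguments, replacing these by `L²`-close
continuous functions moves the image little in `L¹`. -/
theorem exists_contProfile_close [T2Space α] [μ.Regular]
    (hop : ∀ f g, ‖op f g‖ ≤ ‖topToTwo μ f‖ * ‖topToTwo μ g‖)
    (hact : ∀ F G, op (ContinuousMap.toLp ∞ μ ℝ F) (ContinuousMap.toLp ∞ μ ℝ G) =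
      ContinuousMap.toLp 1 μ ℝ (act F G)) {k : ℕ}
    {ν : LevyProkhorov (ProbabilityMeasure (EuclideanSpace ℝ (Fin k × Fin 3)))}
    (hν : ν ∈ (MultiPOp.mk (Ω := α) μ op).profile k) {ε : ℝ} (hε : 0 < ε) :
    ∃ ν' ∈ contProfile μ act k, edist ν ν' ≤ ENNReal.ofReal ε := by
  obtain ⟨f, g, hf, hg, rfl⟩ := hν
  -- Each of the `k` blocks costs `δ + δ + 2δ`, and the available total is `ε²`; `k + 1` avoids
  -- division by zero.
  set δ : ℝ := ε ^ 2 / (4 * (k + 1))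
  have hδ : 0 < δ := by positivity
  choose F hF hFf using fun i => exists_continuousMap_close (hf i) hδ
  choose G hG hGg using fun i => exists_continuousMap_close (hg i) hδ
  refine ⟨_, ⟨F, G, hF, hG, rfl⟩, ?_⟩
  rw [LevyProkhorov.edist_probabilityMeasure_def]
  change levyProkhorovEDist (μ.map ((MultiPOp.mk (Ω := α) μ op).vec f g))
    (μ.map (contVec act F G)) ≤ _
  have hint : ∀ (H : C(α, ℝ)), Integrable H μ := fun H =>
    (BoundedContinuousFunction.mkOfCompact H).integrable μ
  have hfi : ∀ u : Lp ℝ ∞ μ, Integrable u μ := fun u =>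
    memLp_one_iff_integrable.1 ((Lp.memLp u).mono_exponent le_top)
  have hdiff : ∀ (u : Lp ℝ ∞ μ) (H : C(α, ℝ)),
      ‖topToTwo μ u - ContinuousMap.toLp 2 μ ℝ H‖ ≤ δ → ∫ x, |u x - H x| ∂μ ≤ δ := by
    intro u H h
    refine le_trans (le_of_eq ?_) ((integral_abs_le_norm_two _).trans h)
    refine integral_congr_ae ?_
    filter_upwards [coeFn_topToTwo μ u, ContinuousMap.coeFn_toLp (p := 2) (𝕜 := ℝ) μ H,
      Lp.coeFn_sub (topToTwo μ u) (ContinuousMap.toLp 2 μ ℝ H)] with x h1 h2 h3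
    rw [h3, Pi.sub_apply, h1, h2]
  have hopd : ∀ i, ∫ x, |op (f i) (g i) x - act (F i) (G i) x| ∂μ ≤ 2 * δ := by
    intro i
    have h1 : ∫ x, |op (f i) (g i) x - act (F i) (G i) x| ∂μ =
        ‖op (f i) (g i) - ContinuousMap.toLp 1 μ ℝ (act (F i) (G i))‖ := by
      rw [L1.norm_eq_integral_norm]
      refine integral_congr_ae ?_
      filter_upwards [ContinuousMap.coeFn_toLp (p := 1) (𝕜 := ℝ) μ (act (F i) (G i)),
        Lp.coeFn_sub (op (f i) (g i)) (ContinuousMap.toLp 1 μ ℝ (act (F i) (G i)))] with x h1 h2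
      rw [h2, Pi.sub_apply, h1, Real.norm_eq_abs]
    have h2 : op (f i) (g i) - ContinuousMap.toLp 1 μ ℝ (act (F i) (G i)) =
        op (f i - ContinuousMap.toLp ∞ μ ℝ (F i)) (g i) +
          op (ContinuousMap.toLp ∞ μ ℝ (F i)) (g i - ContinuousMap.toLp ∞ μ ℝ (G i)) := by
      rw [← hact, map_sub, map_sub, _root_.sub_apply]
      abel
    have h3 : ‖topToTwo μ (ContinuousMap.toLp ∞ μ ℝ (F i))‖ ≤ 1 := by
      refine norm_topToTwo_le_one ?_
      filter_upwards [ContinuousMap.coeFn_toLp (p := ∞) (𝕜 := ℝ) μ (F i)] with x hx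
      rw [hx]
      exact abs_le.1 (hF i x)
    rw [h1, h2]
    calc _ ≤ _ := norm_add_le _ _
      _ ≤ δ * 1 + 1 * δ := by
          refine add_le_add ((hop _ _).trans ?_) ((hop _ _).trans ?_)
          · rw [map_sub, topToTwo_toLp]
            exact mul_le_mul (hFf i) (norm_topToTwo_le_one (hg i)) (norm_nonneg _) hδ.le
          · rw [map_sub, topToTwo_toLp]
            rw [topToTwo_toLp] at h3 ⊢
            exact mul_le_mul h3 (hGg i) (norm_nonneg _) zero_le_one
      _ = 2 * δ := by ring
  refine levyProkhorovEDist_map_le_of_integral (MultiPOp.measurable_vec _ f g)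
    (continuous_contVec act F G).measurable ?_ hε ?_
  · rintro ⟨i, c⟩
    fin_cases c
    · exact (hfi (f i)).sub (hint _)
    · exact (hfi (g i)).sub (hint _)
    · exact (L1.integrable_coeFn (op (f i) (g i))).sub (hint _)
  · rw [sum_fin_prod_three]
    calc _ ≤ ∑ _i : Fin k, (δ + δ + 2 * δ) := by
          refine Finset.sum_le_sum fun i _ => add_le_add (add_le_add ?_ ?_) ?_
          · exact hdiff _ _ (hFf i)
          · exact hdiff _ _ (hGg i)
          · exact hopd i
      _ = k * (4 * δ) := by
          rw [Finset.sum_const, Finset.card_univ, Fintype.card_fin, nsmul_eq_mul]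
          ring
      _ ≤ (k + 1) * (4 * δ) := by
          gcongr
          linarith
      _ = ε ^ 2 := by
          simp only [δ]
          field_simp

end LimitOperator

/-! ### Convergence of the profiles to the profile of the limit operator -/

section Convergence

/-- Probability measures are at Lévy–Prokhorov distance at most `1`, and profiles are nonempty. This
provides the dominating series for `dM`. -/
theorem MultiPOp.hausdorffEDist_profile_le_one (A : MultiPOp.{u}) (B : MultiPOp.{v}) (k : ℕ) :
    Metric.hausdorffEDist (A.profile k) (B.profile k) ≤ 1 := by
  have hle : ∀ ν ν' : LevyProkhorov (ProbabilityMeasure (EuclideanSpace ℝ (Fin k × Fin 3))),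
      edist ν ν' ≤ 1 := fun ν ν' => by
    rw [LevyProkhorov.edist_probabilityMeasure_def]
    refine (levyProkhorovEDist_le_max_measure_univ _ _).trans ?_
    simp
  exact Metric.hausdorffEDist_le_of_mem_edist
    (fun ν _ => ⟨_, B.law_mem_profile (fun _ => B.one_mem_unitFun) fun _ => B.one_mem_unitFun,
      hle _ _⟩)
    (fun ν _ => ⟨_, A.law_mem_profile (fun _ => A.one_mem_unitFun) fun _ => A.one_mem_unitFun,
      hle _ _⟩)

theorem MultiPOp.dM_triangle (A : MultiPOp.{u}) (B : MultiPOp.{v}) (C : MultiPOp.{w}) :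
    MultiPOp.dM A C ≤ MultiPOp.dM A B + MultiPOp.dM B C := by
  unfold MultiPOp.dM
  rw [← ENNReal.tsum_add]
  refine ENNReal.tsum_le_tsum fun k => ?_
  rw [← mul_add]
  gcongr
  exact Metric.hausdorffEDist_triangle

/-- Convergence of all profiles implies action convergence. -/
theorem actionConverges_of_tendsto {A : ℕ → MultiPOp.{u}} {L : MultiPOp.{v}}
    (h : ∀ k, Tendsto (fun n => Metric.hausdorffEDist ((A n).profile k) (L.profile k)) atTop (𝓝 0)) :
    ActionConverges A L := by
  refine ⟨fun ε hε => ?_, fun k _ => h k⟩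
  have hlim : Tendsto (fun n => MultiPOp.dM (A n) L) atTop (𝓝 0) := by
    have h1 : ∀ n, MultiPOp.dM (A n) L = ∫⁻ k : ℕ, 2⁻¹ ^ (k + 1) *
        Metric.hausdorffEDist ((A n).profile (k + 1)) (L.profile (k + 1)) ∂Measure.count :=
      fun n => (lintegral_count _).symm
    simp only [h1]
    have h2 : (0 : ℝ≥0∞) = ∫⁻ _k : ℕ, 0 ∂Measure.count := by simp
    rw [h2]
    -- The series is an integral for the counting measure, dominated by the geometric weights.
    refine tendsto_lintegral_of_dominated_convergence (fun k : ℕ => (2⁻¹ : ℝ≥0∞) ^ (k + 1))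
      (fun n => .of_discrete) (fun n => Eventually.of_forall fun k => ?_) ?_
      (Eventually.of_forall fun k => ?_)
    · exact mul_le_of_le_one_right' (MultiPOp.hausdorffEDist_profile_le_one _ _ _)
    · rw [lintegral_count, ENNReal.tsum_geometric_add_one]
      simp
    · have := ENNReal.Tendsto.const_mul (a := (2⁻¹ : ℝ≥0∞) ^ (k + 1)) (h (k + 1))
        (Or.inr (by finiteness))
      rwa [mul_zero] at this
  obtain ⟨N, hN⟩ := eventually_atTop.1 (hlim.eventually_lt_const (ENNReal.half_pos hε.ne'))
  refine ⟨N, fun m hm n hn => ?_⟩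
  calc MultiPOp.dM (A m) (A n) ≤ MultiPOp.dM (A m) L + MultiPOp.dM L (A n) :=
        MultiPOp.dM_triangle _ _ _
    _ < ε / 2 + ε / 2 := by
        rw [MultiPOp.dM_comm L]
        exact ENNReal.add_lt_add (hN m hm) (hN n hn)
    _ = ε := ENNReal.add_halves ε

/-- Convergence of all profiles along a nonprincipal ultrafilter implies action convergence of a
subsequence. -/
theorem isSubseqLimit_of_ultrafilter {A : ℕ → MultiPOp.{u}} {L : MultiPOp.{v}}
    (h : ∀ k, ∀ ε : ℝ≥0∞, 0 < ε → ∀ᶠ n in (hyperfilter ℕ : Filter ℕ),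
      Metric.hausdorffEDist ((A n).profile k) (L.profile k) ≤ ε) : IsSubseqLimit A L := by
  -- For each `m` finitely many conditions hold on a set of the ultrafilter, which is infinite
  -- because the ultrafilter is nonprincipal; a diagonal subsequence then works for all `k`.
  have hfreq : ∀ m : ℕ, ∃ᶠ n in atTop, ∀ k ≤ m,
      Metric.hausdorffEDist ((A n).profile k) (L.profile k) ≤ (m : ℝ≥0∞)⁻¹ := by
    intro m
    have h1 : ∀ᶠ n in (hyperfilter ℕ : Filter ℕ), ∀ k ∈ Set.Iic m,
        Metric.hausdorffEDist ((A n).profile k) (L.profile k) ≤ (m : ℝ≥0∞)⁻¹ :=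
      (eventually_all_finite (Set.finite_Iic m)).2 fun k _ => h k _ (by simp)
    exact h1.frequently.filter_mono (Nat.cofinite_eq_atTop ▸ hyperfilter_le_cofinite)
  obtain ⟨φ, hφ, hφ'⟩ := extraction_forall_of_frequently hfreq
  refine ⟨φ, hφ, actionConverges_of_tendsto fun k => ?_⟩
  refine tendsto_of_tendsto_of_tendsto_of_le_of_le' tendsto_const_nhds
    ENNReal.tendsto_inv_nat_nhds_zero (Eventually.of_forall fun _ => zero_le) ?_
  filter_upwards [eventually_ge_atTop k] with n hn
  exact hφ' n k hn

variable {V : ℕ → Type} [∀ n, Fintype (V n)] [∀ n, Nonempty (V n)]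
  {T : ∀ n, V n → V n → V n → ℝ}

/-- The action on continuous functions extends to `L²` by density and is then restricted to `L^∞`.
-/
theorem exists_limitOp (hT : ∀ n i j k, |T n i j k| ≤ 1 / (Fintype.card (V n) : ℝ))
    {U : Ultrafilter ℕ} {μ : Measure (Ultrafilter (Σ n, Sym2 (V n)))}
    [IsProbabilityMeasure μ] [μ.Regular]
    (hμ : ∀ F : C(Ultrafilter (Σ n, Sym2 (V n)), ℝ),
      Tendsto (fun n => ∫ x, F (limitPoint n x) ∂(unif (V n))) U (𝓝 (∫ p, F p ∂μ))) :
    ∃ op : Lp ℝ ∞ μ →L[ℝ] Lp ℝ ∞ μ →L[ℝ] Lp ℝ 1 μ,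
      (∀ f g, ‖op f g‖ ≤ ‖topToTwo μ f‖ * ‖topToTwo μ g‖) ∧
      ∀ F G, op (ContinuousMap.toLp ∞ μ ℝ F) (ContinuousMap.toLp ∞ μ ℝ G) =
        ContinuousMap.toLp 1 μ ℝ (limitAction hT F G) := by
  obtain ⟨B, hB1, hB2⟩ := exists_bilinear_extension
    (ContinuousMap.toLp 2 μ ℝ : C(Ultrafilter (Σ n, Sym2 (V n)), ℝ) →L[ℝ] Lp ℝ 2 μ).toLinearMap
    (ContinuousMap.toLp_denseRange ℝ μ ℝ (by norm_num)) (limitBilin hT μ)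
    (norm_toLp_limitAction_le hT hμ)
  refine ⟨B.bilinearComp (topToTwo μ) (topToTwo μ), fun f g => hB2 _ _, fun F G => ?_⟩
  rw [ContinuousLinearMap.bilinearComp_apply, topToTwo_toLp, topToTwo_toLp]
  exact hB1 F G

/-- The law of the restrictions of continuous functions to the `n`-th structure. -/
noncomputable def levelLaw (T : ∀ n, V n → V n → V n → ℝ) {k : ℕ}
    (F G : Fin k → C(Ultrafilter (Σ n, Sym2 (V n)), ℝ)) (n : ℕ) :
    ProbabilityMeasure (EuclideanSpace ℝ (Fin k × Fin 3)) :=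
  ⟨(unif (V n)).map (tensorVec (T n) (fun i x => F i (limitPoint n x))
      fun i x => G i (limitPoint n x)),
    Measure.isProbabilityMeasure_map (measurable_tensorVec
      (fun i => (F i).continuous.measurable.comp (measurable_limitPoint n))
      fun i => (G i).continuous.measurable.comp (measurable_limitPoint n)).aemeasurable⟩

theorem levelLaw_mem_profile {k : ℕ} {F G : Fin k → C(Ultrafilter (Σ n, Sym2 (V n)), ℝ)}
    (hF : ∀ i x, |F i x| ≤ 1) (hG : ∀ i x, |G i x| ≤ 1) (n : ℕ) :
    LevyProkhorov.ofMeasure (levelLaw T F G n) ∈ (twoActionOp (T n)).profile k :=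
  mem_profile_twoActionOp.2 ⟨_, _,
    fun i => (F i).continuous.measurable.comp (measurable_limitPoint n),
    fun i => (G i).continuous.measurable.comp (measurable_limitPoint n),
    fun i _ => hF i _, fun i _ => hG i _, rfl⟩

/-- The vector of continuous functions restricts at level `n` to the vector of the `n`-th 2-action,
so weak convergence is the defining property of `μ` applied to continuous test functions of this
vector. -/
theorem tendsto_levelLaw (hT : ∀ n i j k, |T n i j k| ≤ 1 / (Fintype.card (V n) : ℝ))
    {U : Ultrafilter ℕ} {μ : Measure (Ultrafilter (Σ n, Sym2 (V n)))}
    [IsProbabilityMeasure μ]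
    (hμ : ∀ F : C(Ultrafilter (Σ n, Sym2 (V n)), ℝ),
      Tendsto (fun n => ∫ x, F (limitPoint n x) ∂(unif (V n))) U (𝓝 (∫ p, F p ∂μ)))
    {k : ℕ} (F G : Fin k → C(Ultrafilter (Σ n, Sym2 (V n)), ℝ)) :
    Tendsto (fun n => LevyProkhorov.ofMeasure (levelLaw T F G n)) U
      (𝓝 (LevyProkhorov.ofMeasure (contLaw μ (limitAction hT) F G))) := by
  refine (LevyProkhorov.continuous_ofMeasure_probabilityMeasure.tendsto _).comp ?_
  refine ProbabilityMeasure.tendsto_iff_forall_integral_tendsto.2 fun φ => ?_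
  have hc := continuous_contVec (limitAction hT) F G
  have h := hμ ⟨fun p => φ (contVec (limitAction hT) F G p), φ.continuous.comp hc⟩
  have h1 : ∫ ω, φ ω ∂(contLaw μ (limitAction hT) F G :
      Measure (EuclideanSpace ℝ (Fin k × Fin 3))) =
      ∫ p, φ (contVec (limitAction hT) F G p) ∂μ :=
    integral_map hc.measurable.aemeasurable φ.continuous.aestronglyMeasurable
  rw [h1]
  refine h.congr fun n => ?_
  have hvec : ∀ x, contVec (limitAction hT) F G (limitPoint n x) =
      tensorVec (T n) (fun i x => F i (limitPoint n x)) (fun i x => G i (limitPoint n x)) x := by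
    intro x
    unfold contVec tensorVec
    simp only [limitAction_limitPoint]
  change ∫ x, φ (contVec (limitAction hT) F G (limitPoint n x)) ∂(unif (V n)) = _
  simp only [hvec]
  exact (integral_map (measurable_tensorVec
    (fun i => (F i).continuous.measurable.comp (measurable_limitPoint n))
    fun i => (G i).continuous.measurable.comp (measurable_limitPoint n)).aemeasurable
    φ.continuous.aestronglyMeasurable).symm

theorem eventually_hausdorffEDist_le
    (hT : ∀ n i j k, |T n i j k| ≤ 1 / (Fintype.card (V n) : ℝ))
    {U : Ultrafilter ℕ}
    {μ : Measure (Ultrafilter (Σ n, Sym2 (V n)))} [IsProbabilityMeasure μ] [μ.Regular]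
    (hμ : ∀ F : C(Ultrafilter (Σ n, Sym2 (V n)), ℝ),
      Tendsto (fun n => ∫ x, F (limitPoint n x) ∂(unif (V n))) U (𝓝 (∫ p, F p ∂μ)))
    {op : Lp ℝ ∞ μ →L[ℝ] Lp ℝ ∞ μ →L[ℝ] Lp ℝ 1 μ}
    (hop : ∀ f g, ‖op f g‖ ≤ ‖topToTwo μ f‖ * ‖topToTwo μ g‖)
    (hact : ∀ F G, op (ContinuousMap.toLp ∞ μ ℝ F) (ContinuousMap.toLp ∞ μ ℝ G) =
      ContinuousMap.toLp 1 μ ℝ (limitAction hT F G)) (k : ℕ) {ε : ℝ} (hε : 0 < ε) :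
    ∀ᶠ n in (U : Filter ℕ), Metric.hausdorffEDist ((twoActionOp (T n)).profile k)
      ((MultiPOp.mk (Ω := Ultrafilter (Σ n, Sym2 (V n))) μ op).profile k) ≤
        ENNReal.ofReal ε := by
  set L := MultiPOp.mk (Ω := Ultrafilter (Σ n, Sym2 (V n))) μ op with hL
  have hε3 : (0 : ℝ≥0∞) < ENNReal.ofReal (ε / 3) := ENNReal.ofReal_pos.2 (by positivity)
  have hA : ∀ᶠ n in (U : Filter ℕ), ∀ ν ∈ (twoActionOp (T n)).profile k, ∃ ν' ∈ L.profile k,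
      edist ν ν' ≤ ENNReal.ofReal ε := by
    by_contra hfail
    -- For an ultrafilter, failing to hold eventually means eventually failing. Witnesses of failure
    -- are chosen level by level, with zero functions at the levels where nothing fails, and glued
    -- to continuous functions.
    have hcon := Ultrafilter.eventually_not.2 hfail
    have hfg : ∀ n, ∃ f g : Fin k → SymPair (V n) → ℝ, (∀ i, Measurable (f i)) ∧
        (∀ i, Measurable (g i)) ∧ (∀ i x, |f i x| ≤ 1) ∧ (∀ i x, |g i x| ≤ 1) ∧
        ((¬ ∀ ν ∈ (twoActionOp (T n)).profile k, ∃ ν' ∈ L.profile k,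
          edist ν ν' ≤ ENNReal.ofReal ε) →
        ∀ ν : LevyProkhorov (ProbabilityMeasure (EuclideanSpace ℝ (Fin k × Fin 3))),
          (ν.toMeasure : Measure (EuclideanSpace ℝ (Fin k × Fin 3))) =
            (unif (V n)).map (tensorVec (T n) f g) →
          ∀ ν' ∈ L.profile k, ENNReal.ofReal ε < edist ν ν') := by
      intro n
      by_cases hn : ∀ ν ∈ (twoActionOp (T n)).profile k, ∃ ν' ∈ L.profile k,
          edist ν ν' ≤ ENNReal.ofReal ε
      · exact ⟨fun _ _ => 0, fun _ _ => 0, fun _ => measurable_const, fun _ => measurable_const,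
          fun _ _ => by simp, fun _ _ => by simp, fun h => absurd hn h⟩
      · have hn' := hn
        push Not at hn'
        obtain ⟨ν, hν, hνd⟩ := hn'
        obtain ⟨f, g, hfm, hgm, hf, hg, hνe⟩ := mem_profile_twoActionOp.1 hν
        refine ⟨f, g, hfm, hgm, hf, hg, fun _ ν₁ hν₁ => ?_⟩
        have : ν₁ = ν := LevyProkhorov.toMeasure_injective
          (ProbabilityMeasure.toMeasure_injective (hν₁.trans hνe.symm))
        rw [this]
        exact hνd
    choose f g hfm hgm hf hg hfar using hfg
    choose F hF hF1 using fun i => exists_continuousMap_limitPoint (f := fun n => f n i)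
      (fun n => hfm n i) (fun n => hf n i)
    choose G hG hG1 using fun i => exists_continuousMap_limitPoint (f := fun n => g n i)
      (fun n => hgm n i) (fun n => hg n i)
    have hmem : LevyProkhorov.ofMeasure (contLaw μ (limitAction hT) F G) ∈ L.profile k :=
      contProfile_subset_profile hact k ⟨F, G, hF1, hG1, rfl⟩
    have hclose := EMetric.tendsto_nhds.1 (tendsto_levelLaw hT hμ F G) _
      (ENNReal.ofReal_pos.2 hε)
    obtain ⟨n, hn1, hn2⟩ := (hcon.and hclose).exists
    refine absurd (hfar n hn1 (LevyProkhorov.ofMeasure (levelLaw T F G n)) ?_ _ hmem) hn2.not_gt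
    change (unif (V n)).map (tensorVec (T n) (fun i x => F i (limitPoint n x))
      fun i x => G i (limitPoint n x)) = _
    simp only [hF, hG]
  have hB : ∀ᶠ n in (U : Filter ℕ), ∀ ν ∈ L.profile k, ∃ ν' ∈ (twoActionOp (T n)).profile k,
      edist ν ν' ≤ ENNReal.ofReal ε := by
    -- The three thirds of `ε` are spent on passing to continuous functions, on passing to the net,
    -- and on comparing the finitely many net points with level `n`.
    obtain ⟨t, htsub, htfin, htcov⟩ := EMetric.totallyBounded_iff'.1
      (totallyBounded_contProfile (μ := μ) (abs_limitAction_le hT) k) _ hε3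
    have hnet : ∀ᶠ n in (U : Filter ℕ), ∀ ν ∈ t, ∃ ν' ∈ (twoActionOp (T n)).profile k,
        edist ν ν' ≤ ENNReal.ofReal (ε / 3) := by
      refine (eventually_all_finite htfin).2 fun ν hν => ?_
      obtain ⟨F, G, hF, hG, rfl⟩ := htsub hν
      filter_upwards [EMetric.tendsto_nhds.1 (tendsto_levelLaw hT hμ F G) _ hε3] with n hn
      refine ⟨_, levelLaw_mem_profile hF hG n, ?_⟩
      rw [edist_comm]
      exact hn.le
    filter_upwards [hnet] with n hn ν hν
    obtain ⟨ν₁, hν₁, hd₁⟩ := exists_contProfile_close hop hact hν (by positivity : 0 < ε / 3)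
    obtain ⟨ν₂, hν₂, hd₂⟩ := Set.mem_iUnion₂.1 (htcov hν₁)
    obtain ⟨ν₃, hν₃, hd₃⟩ := hn ν₂ hν₂
    refine ⟨ν₃, hν₃, ?_⟩
    calc edist ν ν₃ ≤ edist ν ν₁ + edist ν₁ ν₂ + edist ν₂ ν₃ := edist_triangle4 _ _ _ _
      _ ≤ ENNReal.ofReal (ε / 3) + ENNReal.ofReal (ε / 3) + ENNReal.ofReal (ε / 3) := by
          gcongr
          exact le_of_lt hd₂
      _ = ENNReal.ofReal ε := by
          rw [← ENNReal.ofReal_add (by positivity) (by positivity),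
            ← ENNReal.ofReal_add (by positivity) (by positivity)]
          congr 1
          ring
  filter_upwards [hA, hB] with n hn1 hn2
  exact Metric.hausdorffEDist_le_of_mem_edist hn1 hn2

/-- Every sequence of 2-actions of tensors with entries of size at most `1/n` has a subsequence
with an action convergence limit. -/
theorem exists_isSubseqLimit
    (hT : ∀ n i j k, |T n i j k| ≤ 1 / (Fintype.card (V n) : ℝ)) :
    ∃ L : MultiPOp.{0}, IsSubseqLimit (fun n => twoActionOp (T n)) L := by
  obtain ⟨μ, hprob, hreg, hμ⟩ := exists_limitMeasure V (hyperfilter ℕ)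
  obtain ⟨op, hop, hact⟩ := exists_limitOp hT hμ
  refine ⟨MultiPOp.mk (Ω := Ultrafilter (Σ n, Sym2 (V n))) μ op,
    isSubseqLimit_of_ultrafilter fun k ε hε => ?_⟩
  obtain ⟨δ, hδ, hδε⟩ := ENNReal.lt_iff_exists_nnreal_btwn.1 hε
  filter_upwards [eventually_hausdorffEDist_le hT hμ hop hact k (ε := δ)
    (by exact_mod_cast hδ)] with n hn
  refine hn.trans ?_
  rw [ENNReal.ofReal_coe_nnreal]
  exact hδε.le

end Convergence

/-! ### Comparison of the three sequences -/

theorem abs_sub_le_meanDev {V : Type*} [Fintype V] [Nonempty V] (T : V → V → V → ℝ) (c c' : ℝ) :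
    |c - c'| ≤ meanDev T c + meanDev T c' := by
  have hi : ∀ a : ℝ, Integrable (fun x => |twoAction T (fun _ => 1) (fun _ => 1) x - a|) (unif V) :=
    fun a => ((integrable_unif (measurable_twoAction T (fun _ => 1) (fun _ => 1))).sub
      (integrable_const a)).abs
  unfold meanDev
  rw [← integral_add (hi c) (hi c')]
  calc |c - c'| = ∫ _x, |c - c'| ∂(unif V) := by simp
    _ ≤ _ := integral_mono (integrable_const _) ((hi c).add (hi c')) fun x => by
        refine (abs_sub_le c (twoAction T (fun _ => 1) (fun _ => 1) x) c').trans_eq ?_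
        rw [abs_sub_comm c]
        rfl

theorem abs_normTensor_le {V : Type*} [Fintype V] (H : Hypergraph V) (i j k : V) :
    |normTensor H i j k| ≤ 1 / (Fintype.card V : ℝ) := by
  unfold normTensor
  rw [abs_div, abs_of_nonneg (adjTensor_nonneg H i j k), Nat.abs_cast]
  gcongr
  exact adjTensor_le_one H i j k

/-- The compactness theorem allows arbitrary finite nonempty vertex sets, so it applies directly to
any subsequence. -/
theorem hasSubseqLimits_hypergraphOp (H : ∀ n : ℕ, Hypergraph (Fin (n + 1))) :
    HasSubseqLimits fun n => hypergraphOp (H n) := fun φ _ =>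
  exists_isSubseqLimit (V := fun n => Fin (φ n + 1)) (T := fun n => normTensor (H (φ n)))
    fun n => abs_normTensor_le (H (φ n))

end ActionConv

theorem mainTheorem9 {Ω₀ : Type w} [MeasurableSpace Ω₀] (P : Measure Ω₀) [IsProbabilityMeasure P]
    (H : (n : ℕ) → Ω₀ → Hypergraph (Fin (n + 1)))
    (G : (n : ℕ) → Ω₀ → SimpleGraph (Fin (n + 1)))
    (D : (n : ℕ) → Ω₀ → Digraph (Fin (n + 1)))
    (hH : ∀ n, IsErdosRenyiHypergraph P ⟨1 / 8, by norm_num, by norm_num⟩ 3 (H n))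
    (hG : ∀ n, HasLaw (G n)
      (SimpleGraph.binomialRandom (Fin (n + 1)) ⟨1 / 2, by norm_num, by norm_num⟩) P)
    (hD : ∀ n, IsRandomTournament P (D n)) :
    ∀ᵐ ω ∂P,
      HasSubseqLimits (fun n => hypergraphOp (H n ω)) ∧
      HasSubseqLimits (fun n => hypergraphOp (triangleHypergraph (G n ω))) ∧
      HasSubseqLimits (fun n => hypergraphOp (cycleHypergraph (D n ω))) ∧
      HaveDifferentLimits.{u, v} (fun n => hypergraphOp (H n ω))
        (fun n => hypergraphOp (triangleHypergraph (G n ω))) ∧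
      HaveDifferentLimits.{u, v} (fun n => hypergraphOp (H n ω))
        (fun n => hypergraphOp (cycleHypergraph (D n ω))) ∧
      HaveDifferentLimits.{u, v} (fun n => hypergraphOp (triangleHypergraph (G n ω)))
        (fun n => hypergraphOp (cycleHypergraph (D n ω))) ∧
      Tendsto (fun n => (hypergraphOp (cycleHypergraph (D n ω))).lawOne) atTop
        (𝓝 (diracProba (point 1 1 (1 / 4)))) := by
  filter_upwards [ae_tendsto_meanDev_erdosRenyi P hH, ae_le_meanDev_triangle P hG,
    ae_tendsto_meanDev_tournament P hD] with ω h1 h2 h3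
  -- The constants `1/8` and `1/4` differ by `1/8`, and eventually at most `1/16` of this is taken
  -- up by the deviation from `1/4`.
  have hdiff : ∀ᶠ n in atTop,
      1 / 16 ≤ meanDev (normTensor (cycleHypergraph (D n ω))) (1 / 8) := by
    filter_upwards [h3.eventually_le_const (by norm_num : (0 : ℝ) < 1 / 16)] with n hn
    have h := abs_sub_le_meanDev (normTensor (cycleHypergraph (D n ω))) (1 / 8) (1 / 4)
    norm_num [abs_of_neg] at h hn ⊢
    linarith
  refine ⟨hasSubseqLimits_hypergraphOp _, hasSubseqLimits_hypergraphOp _,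
    hasSubseqLimits_hypergraphOp _, ?_, ?_, ?_, tendsto_lawOne h3⟩
  · exact haveDifferentLimits_of_meanDev (fun n => abs_normTensor_le _) (by norm_num)
      (tendsto_lawOne h1) (by norm_num : (0 : ℝ) < 1 / 8 / 4)
      (h2.mono fun n hn => hn _ (by norm_num))
  · exact haveDifferentLimits_of_meanDev (fun n => abs_normTensor_le _) (by norm_num)
      (tendsto_lawOne h1) (by norm_num : (0 : ℝ) < 1 / 16) hdiff
  -- The sequence with nearly constant codegrees must come first in the criterion, so the comparison
  -- is made in the opposite order and reversed.
  · exact (haveDifferentLimits_of_meanDev (fun n => abs_normTensor_le _) (by norm_num)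
      (tendsto_lawOne h3) (by norm_num : (0 : ℝ) < 1 / 4 / 4)
      (h2.mono fun n hn => hn _ (by norm_num))).symm
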